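/- **Lemma (Additivity with respect to tensor products).** All Hilbert spaces are finite-dimensional and complex, with fixed orthonormal bases; $T_B$ is the partial transpose on the second system, $\preceq$ is the Loewner order, $\|X\|_1=\operatorname{tr}\sqrt{X^\dagger X}$, and $\log$ is taken to base $2$. For a bipartite system $AB$ put $$\mathrm{PPT}_2(A:B)=\big\{\sigma\succeq 0:\ \exists\,\omega\in\mathscr L(\mathcal H_A\otimes\mathcal H_B),\ -\omega\preceq\sigma^{T_B}\preceq\omega,\ \|\omega^{T_B}\|_1\le 1\big\},$$ and for a state (density operator) $\rho$ on $\mathcal H_A\otimes\mathcal H_B$ define the logarithmic fidelity of binegativity $$E_{N,2}^{1/2}(\rho)=-\log\max_{\sigma\in\mathrm{PPT}_2(A:B)}F(\rho,\sigma),\qquad F(\rho,\sigma)=\Big(\operatorname{tr}\big[(\sqrt\sigma\,\rho\sqrt\sigma)^{1/2}\big]\Big)^2,$$ and the value of the semidefinite program $$\widehat F_{N,2}(\rho)=\max\Big\{\tfrac12\operatorname{tr}(X+X^\dagger):\ M,N\succeq0,\ -M^{T_B}+N^{T_B}\preceq\sigma^{T_B}\preceq M^{T_B}-N^{T_B},\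 \operatorname{tr}(M+N)\le1,\ \begin{pmatrix}\rho&X\\X^\dagger&\sigma\end{pmatrix}\succeq0\Big\},$$ the maximum being over operators $X,\sigma,M,N$ on $\mathcal H_A\otimes\mathcal H_B$. Let $\rho_0$ and $\rho_1$ be states on $\mathcal H_{A_0}\otimes\mathcal H_{B_0}$ and $\mathcal H_{A_1}\otimes\mathcal H_{B_1}$ (for instance on two copies of the same $\mathcal H_A\otimes\mathcal H_B$), and regard $\rho_0\otimes\rho_1$ as a bipartite state with respect to the cut $A_0A_1:B_0B_1$. Then $$E_{N,2}^{1/2}(\rho_0\otimes\rho_1)=E_{N,2}^{1/2}(\rho_0)+E_{N,2}^{1/2}(\rho_1)$$ and $$\widehat F_{N,2}(\rho_0\otimes\rho_1)=\widehat F_{N,2}(\rho_0)\,\widehat F_{N,2}(\rho_1).$$ -/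

import Mathlib

open scoped MatrixOrder ComplexOrder Kronecker

/-- `ρ` is a density operator (quantum state) on the space with orthonormal basis `n`. -/
def IsDensity {n : Type*} [Fintype n] (ρ : Matrix n n ℂ) : Prop :=
  ρ.PosSemidef ∧ ρ.trace = 1

/-- The partial transpose over the second system `B`, in the computational basis. -/
def partialTransposeB {A B : Type*} (X : Matrix (A × B) (A × B) ℂ) :
    Matrix (A × B) (A × B) ℂ :=
  Matrix.of fun i j => X (i.1, j.2) (j.1, i.2)

/-- The trace norm `‖X‖₁ = tr √(Xᴴ X)` (a nonnegative real number). -/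
noncomputable def traceNorm {n : Type*} [Fintype n] [DecidableEq n] (X : Matrix n n ℂ) : ℝ :=
  (CFC.sqrt (X.conjTranspose * X)).trace.re

/-- The Uhlmann fidelity `F(ρ, σ) = (tr (√σ ρ √σ)^{1/2})²` of positive semidefinite operators. -/
noncomputable def fidelity {n : Type*} [Fintype n] [DecidableEq n] (ρ σ : Matrix n n ℂ) : ℝ :=
  (CFC.sqrt (CFC.sqrt σ * ρ * CFC.sqrt σ)).trace.re ^ 2

/-- The set `PPT₂(A : B)` of sub-states; `≤` is the Loewner order (the difference is positive
semidefinite), so that `ω` is automatically Hermitian. -/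
def PPT2 (A B : Type*) [Fintype A] [Fintype B] [DecidableEq A] [DecidableEq B] :
    Set (Matrix (A × B) (A × B) ℂ) :=
  {σ | 0 ≤ σ ∧ ∃ ω : Matrix (A × B) (A × B) ℂ,
    -ω ≤ partialTransposeB σ ∧ partialTransposeB σ ≤ ω ∧ traceNorm (partialTransposeB ω) ≤ 1}

/-- The logarithmic fidelity of binegativity `- log₂ max_{σ ∈ PPT₂(A : B)} F(ρ, σ)`. -/
noncomputable def logFidelityBinegativity {A B : Type*} [Fintype A] [Fintype B]
    [DecidableEq A] [DecidableEq B] (ρ : Matrix (A × B) (A × B) ℂ) : ℝ :=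
  -Real.logb 2 (sSup (fidelity ρ '' PPT2 A B))

/-- The objective values `½ tr (X + Xᴴ)` of the feasible points of the semidefinite program. -/
def sdpValues {A B : Type*} [Fintype A] [Fintype B] [DecidableEq A] [DecidableEq B]
    (ρ : Matrix (A × B) (A × B) ℂ) : Set ℝ :=
  {v | ∃ X σ M N : Matrix (A × B) (A × B) ℂ,
    0 ≤ M ∧ 0 ≤ N ∧
    -partialTransposeB M + partialTransposeB N ≤ partialTransposeB σ ∧
    partialTransposeB σ ≤ partialTransposeB M - partialTransposeB N ∧
    (M + N).trace ≤ 1 ∧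
    (Matrix.fromBlocks ρ X X.conjTranspose σ).PosSemidef ∧
    v = (1 / 2) * (X + X.conjTranspose).trace.re}

/-- The optimal value of the semidefinite program, `max {½ tr (X + Xᴴ)}`. -/
noncomputable def sdpFidelity {A B : Type*} [Fintype A] [Fintype B]
    [DecidableEq A] [DecidableEq B] (ρ : Matrix (A × B) (A × B) ℂ) : ℝ :=
  sSup (sdpValues ρ)

/-- The tensor product `ρ₀ ⊗ ρ₁` of two bipartite operators, regarded as an operator on the
bipartite system with first party `A₀ × A₁` and second party `B₀ × B₁`. -/
def bipartiteTensor {A₀ B₀ A₁ B₁ : Type*} (ρ₀ : Matrix (A₀ × B₀) (A₀ × B₀) ℂ)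
    (ρ₁ : Matrix (A₁ × B₁) (A₁ × B₁) ℂ) :
    Matrix ((A₀ × A₁) × (B₀ × B₁)) ((A₀ × A₁) × (B₀ × B₁)) ℂ :=
  (ρ₀ ⊗ₖ ρ₁).submatrix (Equiv.prodProdProdComm A₀ A₁ B₀ B₁)
    (Equiv.prodProdProdComm A₀ A₁ B₀ B₁)

section attained

open scoped Matrix.Norms.L2Operator
open Matrix

lemma isCompact_posSemidef_trace_le {n : Type*} [Fintype n] [DecidableEq n] (c : ℝ) :
    IsCompact {P : Matrix n n ℂ | 0 ≤ P ∧ P.trace.re ≤ c} := by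
  have htr : ∀ B : Matrix n n ℂ, (Bᴴ * B).trace.re = ∑ j, ∑ i, ‖B i j‖ ^ 2 := by
    intro B
    simp [Matrix.trace, Matrix.mul_apply, ← Complex.normSq_eq_norm_sq, Complex.normSq_apply]
  have hK : IsCompact ({B : Matrix n n ℂ | ∀ i, B i ∈ {r : n → ℂ | ∀ j, r j ∈
      Metric.closedBall (0 : ℂ) (√c)}} ∩ {B | (Bᴴ * B).trace.re ≤ c}) := by
    refine IsCompact.inter_right ?_ ?_
    · exact isCompact_pi_infinite fun _ => isCompact_pi_infinite fun _ =>
        isCompact_closedBall _ _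
    · exact isClosed_le (by fun_prop) continuous_const
  convert hK.image (f := fun B : Matrix n n ℂ => Bᴴ * B) (by fun_prop) using 1
  ext P
  constructor
  · rintro ⟨h0, hc⟩
    have hs : (CFC.sqrt P)ᴴ * CFC.sqrt P = P := by
      have h1 : (CFC.sqrt P)ᴴ = CFC.sqrt P :=
        (CFC.sqrt_nonneg P).posSemidef.isHermitian
      rw [h1, CFC.sqrt_mul_sqrt_self P h0]
    refine ⟨CFC.sqrt P, ⟨fun i j => ?_, ?_⟩, hs⟩
    · rw [mem_closedBall_zero_iff]
      refine Real.le_sqrt_of_sq_le (le_trans ?_ hc)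
      conv_rhs => rw [← hs]
      rw [htr]
      refine le_trans ?_ (Finset.single_le_sum (f := fun j => ∑ i, ‖CFC.sqrt P i j‖ ^ 2)
        (fun _ _ => by positivity) (Finset.mem_univ j))
      exact Finset.single_le_sum (f := fun i => ‖CFC.sqrt P i j‖ ^ 2)
        (fun _ _ => by positivity) (Finset.mem_univ i)
    · simpa [hs] using hc
  · rintro ⟨B, ⟨-, h⟩, rfl⟩
    exact ⟨(posSemidef_conjTranspose_mul_self B).nonneg, h⟩

lemma trace_partialTransposeB {A B : Type*} [Fintype A] [Fintype B]
    (X : Matrix (A × B) (A × B) ℂ) :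
    (partialTransposeB X).trace = X.trace := rfl

lemma continuous_partialTransposeB {A B : Type*} :
    Continuous (partialTransposeB : Matrix (A × B) (A × B) ℂ → _) := by
  unfold partialTransposeB
  exact continuous_matrix fun i j => by simp only [of_apply]; fun_prop

lemma re_trace_mono {n : Type*} [Fintype n] {X Y : Matrix n n ℂ} (h : X ≤ Y) :
    X.trace.re ≤ Y.trace.re := by
  have := (Complex.le_def.mp (Matrix.le_iff.mp h).trace_nonneg).1
  rw [trace_sub] at this
  simpa using this

lemma nonneg_of_neg_le_of_le {n : Type*} [Fintype n] [DecidableEq n] {X Y : Matrix n n ℂ}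
    (h : -Y ≤ X) (h' : X ≤ Y) : 0 ≤ Y := by
  have h2 : (0 : Matrix n n ℂ) ≤ (2 : ℝ) • Y := by
    have := add_nonneg (sub_nonneg.mpr h) (sub_nonneg.mpr h')
    convert this using 1
    rw [two_smul]; abel
  have := smul_nonneg (by norm_num : (0 : ℝ) ≤ 1 / 2) h2
  simpa [smul_smul] using this

lemma isHermitian_partialTransposeB {A B : Type*} {X : Matrix (A × B) (A × B) ℂ}
    (h : X.IsHermitian) : (partialTransposeB X).IsHermitian := by
  ext i j
  exact h.apply (i.1, j.2) (j.1, i.2)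

lemma trace_le_traceNorm {n : Type*} [Fintype n] [DecidableEq n] {X : Matrix n n ℂ}
    (h : X.IsHermitian) : X.trace.re ≤ traceNorm X := by
  have h1 : X ≤ CFC.abs X := by
    rw [← sub_nonneg, CFC.abs_sub_self X h]
    exact smul_nonneg (by norm_num) (CFC.negPart_nonneg X)
  exact re_trace_mono h1

lemma isCompact_PPT2 {A B : Type*} [Fintype A] [Fintype B] [DecidableEq A]
    [DecidableEq B] :
    IsCompact (PPT2 A B) := by
  have hK := ((isCompact_posSemidef_trace_le (n := A × B) 1).prod
    (isCompact_posSemidef_trace_le (n := A × B) 1))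
  have hT := continuous_partialTransposeB (A := A) (B := B)
  have hC : IsClosed {p : Matrix (A × B) (A × B) ℂ × Matrix (A × B) (A × B) ℂ |
      -p.2 ≤ partialTransposeB p.1 ∧ partialTransposeB p.1 ≤ p.2 ∧
        traceNorm (partialTransposeB p.2) ≤ 1} := by
    have hN : Continuous (traceNorm : Matrix (A × B) (A × B) ℂ → ℝ) := by
      have : Continuous (CFC.abs : Matrix (A × B) (A × B) ℂ → _) := CFC.continuous_abs
      change Continuous fun X : Matrix (A × B) (A × B) ℂ => (CFC.abs X).trace.re
      fun_prop
    refine IsClosed.and ?_ (IsClosed.and ?_ ?_)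
    all_goals exact isClosed_le (by fun_prop) (by fun_prop)
  convert (hK.inter_right hC).image continuous_fst using 1
  ext σ
  constructor
  · rintro ⟨h0, ω, h1, h2, h3⟩
    have hω : 0 ≤ ω := nonneg_of_neg_le_of_le h1 h2
    have hω1 : ω.trace.re ≤ 1 := by
      rw [← trace_partialTransposeB]
      exact (trace_le_traceNorm
        (isHermitian_partialTransposeB hω.posSemidef.isHermitian)).trans h3
    refine ⟨(σ, ω), ⟨⟨⟨h0, ?_⟩, hω, hω1⟩, h1, h2, h3⟩, rfl⟩
    rw [← trace_partialTransposeB]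
    exact (re_trace_mono h2).trans hω1
  · rintro ⟨⟨σ', ω⟩, ⟨⟨⟨h0, -⟩, -⟩, h⟩, rfl⟩
    exact ⟨h0, ω, h⟩

/-- The supremum in the definition of `logFidelityBinegativity` is a maximum. -/
theorem isGreatest_fidelity_PPT2 {A B : Type*} [Fintype A] [Fintype B] [DecidableEq A]
    [DecidableEq B]
    {ρ : Matrix (A × B) (A × B) ℂ} (hρ : IsDensity ρ) :
    IsGreatest (fidelity ρ '' PPT2 A B) (sSup (fidelity ρ '' PPT2 A B)) := by
  have hs : ContinuousOn (CFC.sqrt : Matrix (A × B) (A × B) ℂ → _) {σ | 0 ≤ σ} :=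
    CFC.continuousOn_sqrt
  have hg : ContinuousOn (fun σ => CFC.sqrt σ * ρ * CFC.sqrt σ)
      {σ : Matrix (A × B) (A × B) ℂ | 0 ≤ σ} := (hs.mul continuousOn_const).mul hs
  have hf : ContinuousOn (fidelity ρ) (PPT2 A B) := by
    have h := hs.comp hg fun σ hσ => by
      have h2 : (CFC.sqrt σ)ᴴ = CFC.sqrt σ := (CFC.sqrt_nonneg σ).posSemidef.isHermitian
      have h3 := hρ.1.mul_mul_conjTranspose_same (CFC.sqrt σ)
      rw [h2] at h3
      exact h3.nonneg
    have ht : Continuous fun X : Matrix (A × B) (A × B) ℂ => X.trace.re ^ 2 := by fun_prop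
    exact (ht.comp_continuousOn h).mono fun σ hσ => hσ.1
  refine (isCompact_PPT2.image_of_continuousOn hf).isGreatest_sSup (Set.Nonempty.image _ ⟨0, ?_⟩)
  have h0 : partialTransposeB (0 : Matrix (A × B) (A × B) ℂ) = 0 := rfl
  exact ⟨le_rfl, 0, by simp [h0], by simp [h0], by simp [h0, traceNorm]⟩

/-- The supremum in the definition of `sdpFidelity` is a maximum. -/
theorem isGreatest_sdpValues {A B : Type*} [Fintype A] [Fintype B] [DecidableEq A]
    [DecidableEq B]
    {ρ : Matrix (A × B) (A × B) ℂ} (hρ : IsDensity ρ) :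
    IsGreatest (sdpValues ρ) (sdpFidelity ρ) := by
  have hT := continuous_partialTransposeB (A := A) (B := B)
  have h0 : partialTransposeB (0 : Matrix (A × B) (A × B) ℂ) = 0 := rfl
  have hK := (isCompact_posSemidef_trace_le (n := (A × B) ⊕ (A × B)) 2).prod
    ((isCompact_posSemidef_trace_le (n := A × B) 1).prod
    (isCompact_posSemidef_trace_le (n := A × B) 1))
  have h11 : Continuous (toBlocks₁₁ : Matrix ((A × B) ⊕ (A × B)) ((A × B) ⊕ (A × B)) ℂ → _) :=
    continuous_matrix fun i j => by simp only [toBlocks₁₁, of_apply]; fun_prop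
  have h12 : Continuous (toBlocks₁₂ : Matrix ((A × B) ⊕ (A × B)) ((A × B) ⊕ (A × B)) ℂ → _) :=
    continuous_matrix fun i j => by simp only [toBlocks₁₂, of_apply]; fun_prop
  have h22 : Continuous (toBlocks₂₂ : Matrix ((A × B) ⊕ (A × B)) ((A × B) ⊕ (A × B)) ℂ → _) :=
    continuous_matrix fun i j => by simp only [toBlocks₂₂, of_apply]; fun_prop
  have hC : IsClosed {p : Matrix ((A × B) ⊕ (A × B)) ((A × B) ⊕ (A × B)) ℂ ×
      Matrix (A × B) (A × B) ℂ × Matrix (A × B) (A × B) ℂ |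
      -partialTransposeB p.2.1 + partialTransposeB p.2.2 ≤ partialTransposeB p.1.toBlocks₂₂ ∧
      partialTransposeB p.1.toBlocks₂₂ ≤ partialTransposeB p.2.1 - partialTransposeB p.2.2 ∧
      (p.2.1 + p.2.2).trace ≤ 1 ∧ p.1.toBlocks₁₁ = ρ} := by
    refine IsClosed.and ?_ (IsClosed.and ?_ (IsClosed.and ?_ ?_))
    · exact isClosed_le (by fun_prop) (by fun_prop)
    · exact isClosed_le (by fun_prop) (by fun_prop)
    · exact isClosed_le (by fun_prop) (by fun_prop)
    · exact isClosed_eq (by fun_prop) (by fun_prop)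
  have hc := (hK.inter_right hC).image (f := fun p =>
    (1 / 2) * (p.1.toBlocks₁₂ + p.1.toBlocks₁₂ᴴ).trace.re) (by fun_prop)
  have hS : IsCompact (sdpValues ρ) := by
    convert hc using 1
    apply Set.Subset.antisymm
    · rintro _ ⟨X, σ, M, N, hM, hN, h1, h2, h3, hP, rfl⟩
      have hM0 := re_trace_mono hM
      have hN0 := re_trace_mono hN
      have hr := (Complex.le_def.mp h3).1
      have hσ := re_trace_mono h2
      rw [trace_sub, trace_partialTransposeB, trace_partialTransposeB,
        trace_partialTransposeB] at hσ
      rw [trace_add] at hr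
      simp only [Complex.add_re, Complex.sub_re, Complex.one_re, trace_zero,
        Complex.zero_re] at hM0 hN0 hr hσ
      refine ⟨(fromBlocks ρ X Xᴴ σ, M, N), ⟨⟨⟨hP.nonneg, ?_⟩, ⟨hM, ?_⟩, hN, ?_⟩, ?_⟩, ?_⟩
      · rw [show (fromBlocks ρ X Xᴴ σ).trace = ρ.trace + σ.trace by
          simp [Matrix.trace, Fintype.sum_sum_type], hρ.2, Complex.add_re, Complex.one_re]; linarith
      · linarith
      · linarith
      · exact ⟨by simpa using h1, by simpa using h2, h3, by simp⟩
      · simp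
    · rintro _ ⟨⟨P, M, N⟩, ⟨⟨⟨hP, -⟩, ⟨hM, -⟩, hN, -⟩, h1, h2, h3, rfl⟩, rfl⟩
      refine ⟨P.toBlocks₁₂, P.toBlocks₂₂, M, N, hM, hN, h1, h2, h3, ?_, rfl⟩
      have h21 : P.toBlocks₁₂ᴴ = P.toBlocks₂₁ := by
        ext i j
        exact hP.posSemidef.isHermitian.apply (Sum.inr i) (Sum.inl j)
      rw [h21, fromBlocks_toBlocks]
      exact hP.posSemidef
  refine hS.isGreatest_sSup ⟨_, 0, 0, 0, 0, le_rfl, le_rfl, by simp [h0], by simp [h0],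
    by simp, ?_, rfl⟩
  have h := hρ.1.mul_mul_conjTranspose_same
    (fromRows 1 0 : Matrix ((A × B) ⊕ (A × B)) (A × B) ℂ)
  convert h using 1
  ext (i | i) (j | j) <;>
    simp [conjTranspose_fromRows_eq_fromCols_conjTranspose, fromRows_mul]

end attained

/-!
Write `T` for the partial transpose. The argument is semidefinite programming duality: primal
feasible points multiply under tensor products, so the optimal value is supermultiplicative, and
dual feasible points multiply as well, so it is submultiplicative.

**Primal.** If `(X₀, σ₀, M₀, N₀)` and `(X₁, σ₁, M₁, N₁)` are feasible, then so are `X₀ ⊗ X₁`,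
`σ₀ ⊗ σ₁`, `M₀ ⊗ M₁ + N₀ ⊗ N₁` and `M₀ ⊗ N₁ + N₀ ⊗ M₁`: the differences `M - N` and the sums
`M + N` are multiplicative, symmetric order intervals are stable under tensor products
(`bipartiteTensor_mem_Icc`), and the new block matrix is a principal submatrix of the tensor product
of the old ones (`posSemidef_fromBlocks_bipartiteTensor`).

**Dual.** The dual program minimises `(tr (Y ρ) + μ) / 2` over `Y`, `Q ≥ 0`, `R ≥ 0` and `μ ≥ 0` such
that `-μ ≤ T (Q + R) ≤ μ` and the block matrix with diagonal `Y`, `T (Q - R)` and off-diagonal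
blocks `1` is positive semidefinite (`IsDualFeasible`). The products `Y₀ ⊗ Y₁`,
`Q₀ ⊗ Q₁ + R₀ ⊗ R₁`, `Q₀ ⊗ R₁ + R₀ ⊗ Q₁`, `μ₀ μ₁` are feasible for the same reasons. Rescaling a dual
point turns the arithmetic mean of `tr (Y ρ)` and `μ` into their geometric mean, which is
multiplicative. The absence of a duality gap (`exists_isDualFeasible_of_sdpFidelity_lt`) comes from
the Hahn-Banach theorem: the image of the trace-one base of the primal cone is compact and convex,
and a ray pointing at an unattainable value can be separated from it.

**Fidelity.** For fixed `σ`, the maximum of `Re tr X` over the admissible off-diagonal blocks `X` is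
the square root of the fidelity. For positive definite operators both bounds have explicit witnesses
built from `(√σ ρ √σ)^{1/2}`; the singular case follows by continuity. As `M` and `N` encode the
positive and negative parts of `T ω`, the maximal fidelity over `PPT2` is the square of the
semidefinite optimum (`sSup_fidelity_PPT2`), which is positive, so that the logarithm turns
multiplicativity into additivity.
-/

open Matrix

/-! ### Traces of products and the Loewner order -/

section Trace

variable {n : Type*} [Fintype n]

lemma trace_mul_nonneg_of_nonneg [DecidableEq n] {P Q : Matrix n n ℂ} (hP : 0 ≤ P) (hQ : 0 ≤ Q) :
    0 ≤ (P * Q).trace := by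
  have hs : (CFC.sqrt P)ᴴ = CFC.sqrt P := (CFC.sqrt_nonneg P).posSemidef.isHermitian
  have h := (hQ.posSemidef.mul_mul_conjTranspose_same (CFC.sqrt P)).trace_nonneg
  rwa [hs, trace_mul_comm, ← mul_assoc, CFC.sqrt_mul_sqrt_self P hP] at h

lemma re_trace_mul_nonneg [DecidableEq n] {P Q : Matrix n n ℂ} (hP : 0 ≤ P) (hQ : 0 ≤ Q) :
    0 ≤ (P * Q).trace.re :=
  (Complex.le_def.mp (trace_mul_nonneg_of_nonneg hP hQ)).1

lemma re_trace_mul_mono [DecidableEq n] {P X Y : Matrix n n ℂ} (hP : 0 ≤ P) (h : X ≤ Y) :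
    (P * X).trace.re ≤ (P * Y).trace.re := by
  have := re_trace_mul_nonneg hP (sub_nonneg.mpr h)
  rw [mul_sub, trace_sub, Complex.sub_re] at this
  linarith

/-- The cone of positive semidefinite matrices is self-dual for the trace pairing. -/
lemma nonneg_of_forall_re_trace_mul_nonneg {Y : Matrix n n ℂ} (hY : Y.IsHermitian)
    (h : ∀ P : Matrix n n ℂ, 0 ≤ P → 0 ≤ (Y * P).trace.re) : 0 ≤ Y := by
  rw [nonneg_iff_posSemidef]
  refine PosSemidef.of_dotProduct_mulVec_nonneg hY fun x => ?_
  have h1 := h (vecMulVec x (star x)) (posSemidef_vecMulVec_self_star x).nonneg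
  rw [mul_vecMulVec, trace_vecMulVec, dotProduct_comm] at h1
  rw [Complex.le_def]
  refine ⟨h1, ?_⟩
  have := hY.im_star_dotProduct_mulVec_self x
  simpa using this.symm

/-- Real-linear functionals on Hermitian matrices are trace pairings with Hermitian matrices. -/
lemma exists_isHermitian_re_trace_mul_eq [DecidableEq n] (g : Matrix n n ℂ →ₗ[ℝ] ℝ) :
    ∃ Y : Matrix n n ℂ, Y.IsHermitian ∧
      ∀ X : Matrix n n ℂ, X.IsHermitian → g X = (Y * X).trace.re := by
  let Z : Matrix n n ℂ := of fun j i =>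
    (g (single i j 1) : ℂ) - Complex.I * (g (single i j Complex.I) : ℂ)
  have hZ : ∀ X, g X = (Z * X).trace.re := by
    intro X
    have h1 : ∀ i j, single i j (X i j) =
        (X i j).re • single i j (1 : ℂ) + (X i j).im • single i j Complex.I := by
      intro i j
      rw [smul_single, smul_single, ← single_add]
      congr 1
      apply Complex.ext <;> simp
    conv_lhs => rw [matrix_eq_sum_single X]
    simp only [map_sum, h1, map_add, map_smul, smul_eq_mul]
    rw [Finset.sum_comm]
    simp only [Matrix.trace, diag_apply, mul_apply, Complex.re_sum]
    refine Finset.sum_congr rfl fun j _ => Finset.sum_congr rfl fun i _ => ?_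
    simp [Z]
    ring
  refine ⟨(1 / 2 : ℂ) • (Z + Zᴴ), ?_, fun X hX => ?_⟩
  · simp [IsHermitian, conjTranspose_smul, add_comm]
  · have h2 : (Zᴴ * X).trace.re = (Z * X).trace.re := by
      have : (Zᴴ * X).trace = star (Z * X).trace := by
        rw [← trace_conjTranspose, conjTranspose_mul, hX.eq, trace_mul_comm]
      rw [this]; simp
    rw [hZ, smul_mul_assoc, trace_smul, add_mul, trace_add, smul_eq_mul,
      show (1 / 2 : ℂ) = ((1 / 2 : ℝ) : ℂ) by norm_num, Complex.re_ofReal_mul, Complex.add_re, h2]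
    ring

lemma trace_fromBlocks_mul_fromBlocks (A B C D E F G H : Matrix n n ℂ) :
    (fromBlocks A B C D * fromBlocks E F G H).trace =
      (A * E).trace + (B * G).trace + ((C * F).trace + (D * H).trace) := by
  simp [fromBlocks_multiply, Matrix.trace, Fintype.sum_sum_type, Finset.sum_add_distrib]

/-- Multiplying the off-diagonal blocks by a phase is a diagonal unitary conjugation. -/
lemma Matrix.PosSemidef.fromBlocks_phase [DecidableEq n] {A B D : Matrix n n ℂ}
    (h : (fromBlocks A B Bᴴ D).PosSemidef) {c : ℂ} (hc : ‖c‖ = 1) :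
    (fromBlocks A (c • B) (c • B)ᴴ D).PosSemidef := by
  have hc' : c * star c = 1 := by
    simp [Complex.mul_conj, Complex.normSq_eq_norm_sq, hc]
  have h1 := h.conjTranspose_mul_mul_same
    (fromBlocks 1 0 0 (c • 1) : Matrix (n ⊕ n) (n ⊕ n) ℂ)
  convert h1 using 1
  simp only [fromBlocks_conjTranspose, fromBlocks_multiply]
  simp [conjTranspose_smul, smul_smul]
  rw [show c * (starRingEnd ℂ) c = 1 from hc']
  simp

end Trace

/-! ### Partial transposition -/

section PartialTranspose

variable {A B : Type*}

@[simp] lemma partialTransposeB_partialTransposeB (X : Matrix (A × B) (A × B) ℂ) :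
    partialTransposeB (partialTransposeB X) = X := rfl

@[simp] lemma partialTransposeB_zero :
    partialTransposeB (0 : Matrix (A × B) (A × B) ℂ) = 0 := rfl

lemma partialTransposeB_add (X Y : Matrix (A × B) (A × B) ℂ) :
    partialTransposeB (X + Y) = partialTransposeB X + partialTransposeB Y := rfl

lemma partialTransposeB_neg (X : Matrix (A × B) (A × B) ℂ) :
    partialTransposeB (-X) = -partialTransposeB X := rfl

lemma partialTransposeB_sub (X Y : Matrix (A × B) (A × B) ℂ) :
    partialTransposeB (X - Y) = partialTransposeB X - partialTransposeB Y := rfl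

lemma partialTransposeB_smul {R : Type*} [SMul R ℂ] (c : R) (X : Matrix (A × B) (A × B) ℂ) :
    partialTransposeB (c • X) = c • partialTransposeB X := rfl

@[simp] lemma partialTransposeB_one [DecidableEq A] [DecidableEq B] :
    partialTransposeB (1 : Matrix (A × B) (A × B) ℂ) = 1 := by
  ext ⟨i, j⟩ ⟨k, l⟩
  simp [partialTransposeB, one_apply, eq_comm]

lemma trace_partialTransposeB_mul [Fintype A] [Fintype B] (X Y : Matrix (A × B) (A × B) ℂ) :
    (partialTransposeB X * Y).trace = (X * partialTransposeB Y).trace := by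
  simp only [Matrix.trace, diag_apply, mul_apply, Fintype.sum_prod_type, partialTransposeB,
    of_apply]
  refine Finset.sum_congr rfl fun i _ => ?_
  refine Finset.sum_comm.trans (Eq.trans ?_ Finset.sum_comm)
  exact Finset.sum_congr rfl fun k _ => Finset.sum_comm

end PartialTranspose

/-! ### The bipartite tensor product -/

section Tensor

variable {A₀ B₀ A₁ B₁ : Type*}

lemma partialTransposeB_bipartiteTensor (X : Matrix (A₀ × B₀) (A₀ × B₀) ℂ)
    (Y : Matrix (A₁ × B₁) (A₁ × B₁) ℂ) :
    partialTransposeB (bipartiteTensor X Y) =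
      bipartiteTensor (partialTransposeB X) (partialTransposeB Y) := rfl

lemma bipartiteTensor_add (X : Matrix (A₀ × B₀) (A₀ × B₀) ℂ)
    (Y Y' : Matrix (A₁ × B₁) (A₁ × B₁) ℂ) :
    bipartiteTensor X (Y + Y') = bipartiteTensor X Y + bipartiteTensor X Y' := by
  ext; simp [bipartiteTensor, mul_add]

lemma add_bipartiteTensor (X X' : Matrix (A₀ × B₀) (A₀ × B₀) ℂ)
    (Y : Matrix (A₁ × B₁) (A₁ × B₁) ℂ) :
    bipartiteTensor (X + X') Y = bipartiteTensor X Y + bipartiteTensor X' Y := by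
  ext; simp [bipartiteTensor, add_mul]

lemma bipartiteTensor_sub (X : Matrix (A₀ × B₀) (A₀ × B₀) ℂ)
    (Y Y' : Matrix (A₁ × B₁) (A₁ × B₁) ℂ) :
    bipartiteTensor X (Y - Y') = bipartiteTensor X Y - bipartiteTensor X Y' := by
  ext; simp [bipartiteTensor, mul_sub]

lemma sub_bipartiteTensor (X X' : Matrix (A₀ × B₀) (A₀ × B₀) ℂ)
    (Y : Matrix (A₁ × B₁) (A₁ × B₁) ℂ) :
    bipartiteTensor (X - X') Y = bipartiteTensor X Y - bipartiteTensor X' Y := by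
  ext; simp [bipartiteTensor, sub_mul]

lemma smul_bipartiteTensor (c : ℝ) (X : Matrix (A₀ × B₀) (A₀ × B₀) ℂ)
    (Y : Matrix (A₁ × B₁) (A₁ × B₁) ℂ) :
    bipartiteTensor (c • X) Y = c • bipartiteTensor X Y := by
  ext; simp [bipartiteTensor, mul_assoc]

lemma bipartiteTensor_smul (c : ℝ) (X : Matrix (A₀ × B₀) (A₀ × B₀) ℂ)
    (Y : Matrix (A₁ × B₁) (A₁ × B₁) ℂ) :
    bipartiteTensor X (c • Y) = c • bipartiteTensor X Y := by
  ext; simp [bipartiteTensor, mul_left_comm]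

@[simp] lemma bipartiteTensor_one [DecidableEq A₀] [DecidableEq B₀] [DecidableEq A₁]
    [DecidableEq B₁] :
    bipartiteTensor (1 : Matrix (A₀ × B₀) (A₀ × B₀) ℂ) (1 : Matrix (A₁ × B₁) (A₁ × B₁) ℂ) = 1 := by
  rw [bipartiteTensor, one_kronecker_one, submatrix_one_equiv]

lemma bipartiteTensor_conjTranspose (X : Matrix (A₀ × B₀) (A₀ × B₀) ℂ)
    (Y : Matrix (A₁ × B₁) (A₁ × B₁) ℂ) :
    (bipartiteTensor X Y)ᴴ = bipartiteTensor Xᴴ Yᴴ := by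
  rw [bipartiteTensor, conjTranspose_submatrix, conjTranspose_kronecker, bipartiteTensor]

variable [Fintype A₀] [Fintype B₀] [Fintype A₁] [Fintype B₁]

lemma bipartiteTensor_mul (X X' : Matrix (A₀ × B₀) (A₀ × B₀) ℂ)
    (Y Y' : Matrix (A₁ × B₁) (A₁ × B₁) ℂ) :
    bipartiteTensor X Y * bipartiteTensor X' Y' = bipartiteTensor (X * X') (Y * Y') := by
  rw [bipartiteTensor, bipartiteTensor, submatrix_mul_equiv, ← mul_kronecker_mul, bipartiteTensor]

lemma trace_bipartiteTensor (X : Matrix (A₀ × B₀) (A₀ × B₀) ℂ)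
    (Y : Matrix (A₁ × B₁) (A₁ × B₁) ℂ) :
    (bipartiteTensor X Y).trace = X.trace * Y.trace := by
  rw [← trace_kronecker]
  exact (Equiv.prodProdProdComm A₀ A₁ B₀ B₁).sum_comp fun i => (X ⊗ₖ Y) i i

lemma bipartiteTensor_nonneg [DecidableEq A₀] [DecidableEq B₀] [DecidableEq A₁] [DecidableEq B₁]
    {X : Matrix (A₀ × B₀) (A₀ × B₀) ℂ} {Y : Matrix (A₁ × B₁) (A₁ × B₁) ℂ}
    (hX : 0 ≤ X) (hY : 0 ≤ Y) : 0 ≤ bipartiteTensor X Y :=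
  ((hX.posSemidef.kronecker hY.posSemidef).submatrix _).nonneg

lemma IsDensity.bipartiteTensor [DecidableEq A₀] [DecidableEq B₀] [DecidableEq A₁]
    [DecidableEq B₁] {ρ₀ : Matrix (A₀ × B₀) (A₀ × B₀) ℂ} {ρ₁ : Matrix (A₁ × B₁) (A₁ × B₁) ℂ}
    (h₀ : IsDensity ρ₀) (h₁ : IsDensity ρ₁) : IsDensity (bipartiteTensor ρ₀ ρ₁) :=
  ⟨(bipartiteTensor_nonneg h₀.1.nonneg h₁.1.nonneg).posSemidef, by
    rw [trace_bipartiteTensor, h₀.2, h₁.2, one_mul]⟩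

/-- Order intervals symmetric about zero are stable under tensor products, because
`2 (S₀ ⊗ S₁ ± X₀ ⊗ X₁) = (S₀ + X₀) ⊗ (S₁ ± X₁) + (S₀ - X₀) ⊗ (S₁ ∓ X₁)`. -/
lemma bipartiteTensor_mem_Icc [DecidableEq A₀] [DecidableEq B₀] [DecidableEq A₁] [DecidableEq B₁]
    {X₀ S₀ : Matrix (A₀ × B₀) (A₀ × B₀) ℂ} {X₁ S₁ : Matrix (A₁ × B₁) (A₁ × B₁) ℂ}
    (h₀ : X₀ ∈ Set.Icc (-S₀) S₀) (h₁ : X₁ ∈ Set.Icc (-S₁) S₁) :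
    bipartiteTensor X₀ X₁ ∈ Set.Icc (-bipartiteTensor S₀ S₁) (bipartiteTensor S₀ S₁) := by
  have p₀ : 0 ≤ S₀ + X₀ := by simpa [add_comm] using sub_nonneg.mpr h₀.1
  have m₀ : 0 ≤ S₀ - X₀ := sub_nonneg.mpr h₀.2
  have p₁ : 0 ≤ S₁ + X₁ := by simpa [add_comm] using sub_nonneg.mpr h₁.1
  have m₁ : 0 ≤ S₁ - X₁ := sub_nonneg.mpr h₁.2
  have half : ∀ Z : Matrix ((A₀ × A₁) × (B₀ × B₁)) ((A₀ × A₁) × (B₀ × B₁)) ℂ,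
      0 ≤ Z + Z → 0 ≤ Z := fun Z h => by
    have := smul_nonneg (by norm_num : (0 : ℝ) ≤ 1 / 2) h
    rw [← two_smul ℝ Z, smul_smul] at this
    simpa using this
  constructor
  · rw [← sub_nonneg]
    refine half _ ?_
    convert add_nonneg (bipartiteTensor_nonneg p₀ p₁) (bipartiteTensor_nonneg m₀ m₁) using 1
    simp only [bipartiteTensor_add, add_bipartiteTensor, bipartiteTensor_sub, sub_bipartiteTensor]
    abel
  · rw [← sub_nonneg]
    refine half _ ?_
    convert add_nonneg (bipartiteTensor_nonneg p₀ m₁) (bipartiteTensor_nonneg m₀ p₁) using 1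
    simp only [bipartiteTensor_add, add_bipartiteTensor, bipartiteTensor_sub, sub_bipartiteTensor]
    abel

/-- The block matrix of products is a principal submatrix of the tensor product of the block
matrices. -/
lemma posSemidef_fromBlocks_bipartiteTensor [DecidableEq A₀] [DecidableEq B₀] [DecidableEq A₁]
    [DecidableEq B₁] {a₀ b₀ c₀ d₀ : Matrix (A₀ × B₀) (A₀ × B₀) ℂ}
    {a₁ b₁ c₁ d₁ : Matrix (A₁ × B₁) (A₁ × B₁) ℂ}
    (h₀ : (fromBlocks a₀ b₀ c₀ d₀).PosSemidef) (h₁ : (fromBlocks a₁ b₁ c₁ d₁).PosSemidef) :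
    (fromBlocks (bipartiteTensor a₀ a₁) (bipartiteTensor b₀ b₁) (bipartiteTensor c₀ c₁)
      (bipartiteTensor d₀ d₁)).PosSemidef := by
  let e := Equiv.prodProdProdComm A₀ A₁ B₀ B₁
  let f : ((A₀ × A₁) × (B₀ × B₁)) ⊕ ((A₀ × A₁) × (B₀ × B₁)) →
      ((A₀ × B₀) ⊕ (A₀ × B₀)) × ((A₁ × B₁) ⊕ (A₁ × B₁)) :=
    Sum.elim (fun i => (Sum.inl (e i).1, Sum.inl (e i).2))
      (fun i => (Sum.inr (e i).1, Sum.inr (e i).2))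
  have he : fromBlocks (bipartiteTensor a₀ a₁) (bipartiteTensor b₀ b₁) (bipartiteTensor c₀ c₁)
      (bipartiteTensor d₀ d₁) =
        (fromBlocks a₀ b₀ c₀ d₀ ⊗ₖ fromBlocks a₁ b₁ c₁ d₁).submatrix f f := by
    ext (i | i) (j | j) <;> rfl
  rw [he]
  exact (h₀.kronecker h₁).submatrix f

end Tensor

/-! ### Dual feasible points -/

section Dual

variable {A B : Type*} [Fintype A] [Fintype B] [DecidableEq A] [DecidableEq B]

/-- Feasible points of the dual semidefinite program: `Q` and `R` are the multipliers of the two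
inequalities constraining `partialTransposeB σ`, `μ` is the multiplier of `tr (M + N) ≤ 1`, and `Y`
that of the prescribed upper left block. The dual objective is `(tr (Y ρ) + μ) / 2`. -/
structure IsDualFeasible (Y Q R : Matrix (A × B) (A × B) ℂ) (μ : ℝ) : Prop where
  nonneg : 0 ≤ μ
  nonneg_left : 0 ≤ Q
  nonneg_right : 0 ≤ R
  mem_Icc : partialTransposeB (Q + R) ∈ Set.Icc (-(μ • (1 : Matrix (A × B) (A × B) ℂ))) (μ • 1)
  posSemidef : (fromBlocks Y 1 1 (partialTransposeB (Q - R))).PosSemidef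

lemma re_trace_add_conjTranspose_div_two {n : Type*} [Fintype n] (X : Matrix n n ℂ) :
    (1 / 2) * (X + Xᴴ).trace.re = X.trace.re := by
  rw [trace_add, trace_conjTranspose, Complex.add_re]
  simp
  ring

/-- Weak duality. -/
lemma IsDualFeasible.two_mul_le {Y Q R ρ : Matrix (A × B) (A × B) ℂ} {μ v : ℝ}
    (h : IsDualFeasible Y Q R μ) (hv : v ∈ sdpValues ρ) :
    2 * v ≤ (Y * ρ).trace.re + μ := by
  obtain ⟨X, σ, M, N, hM, hN, h1, h2, h3, hP, rfl⟩ := hv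
  rw [re_trace_add_conjTranspose_div_two]
  have hP' := hP.fromBlocks_phase (c := -1) (by simp)
  rw [neg_one_smul] at hP'
  -- Pairing the dual block matrix with the primal one for `-X` bounds `2 Re tr X` from above.
  have hpair := re_trace_mul_nonneg h.posSemidef.nonneg hP'.nonneg
  rw [trace_fromBlocks_mul_fromBlocks, trace_partialTransposeB_mul] at hpair
  have hX : (Xᴴ).trace.re = X.trace.re := by rw [trace_conjTranspose]; simp
  simp only [one_mul, conjTranspose_neg, trace_neg, Complex.add_re, Complex.neg_re, hX,
    sub_mul, trace_sub, Complex.sub_re] at hpair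
  have hQ := re_trace_mul_mono h.nonneg_left h2
  have hR := re_trace_mul_mono h.nonneg_right h1
  have hM' := re_trace_mul_nonneg hM (sub_nonneg.mpr h.mem_Icc.2)
  have hN' := re_trace_mul_nonneg hN (sub_nonneg.mpr h.mem_Icc.1)
  have hr := (Complex.le_def.mp h3).1
  simp only [mul_sub, mul_add, mul_neg, trace_sub, trace_add, trace_neg, Complex.sub_re,
    Complex.add_re, Complex.neg_re, mul_smul_comm, mul_one, trace_smul, partialTransposeB_add,
    Complex.real_smul, Complex.re_ofReal_mul, Complex.one_re] at hQ hR hM' hN' hr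
  simp only [trace_mul_comm M, trace_mul_comm N, trace_partialTransposeB_mul] at hM' hN'
  nlinarith [mul_le_mul_of_nonneg_left hr h.nonneg]

/-- Conjugating the block matrix of a dual point by `diag (√c, 1 / √c)` rescales the point while
keeping the off-diagonal blocks equal to `1`. -/
lemma IsDualFeasible.rescale {Y Q R : Matrix (A × B) (A × B) ℂ} {μ : ℝ}
    (h : IsDualFeasible Y Q R μ) {c : ℝ} (hc : 0 < c) :
    IsDualFeasible (c • Y) (c⁻¹ • Q) (c⁻¹ • R) (c⁻¹ * μ) := by
  have hc' : 0 ≤ c⁻¹ := by positivity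
  refine ⟨mul_nonneg hc' h.nonneg, smul_nonneg hc' h.nonneg_left, smul_nonneg hc' h.nonneg_right,
    ⟨?_, ?_⟩, ?_⟩
  · have := smul_le_smul_of_nonneg_left h.mem_Icc.1 hc'
    rwa [smul_neg, smul_smul, ← partialTransposeB_smul, smul_add] at this
  · have := smul_le_smul_of_nonneg_left h.mem_Icc.2 hc'
    rwa [smul_smul, ← partialTransposeB_smul, smul_add] at this
  · have h1 := h.posSemidef.conjTranspose_mul_mul_same
      (fromBlocks ((√c : ℝ) • 1) 0 0 ((√c)⁻¹ • 1) : Matrix ((A × B) ⊕ (A × B)) ((A × B) ⊕ (A × B)) ℂ)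
    have hs : √c * √c = c := Real.mul_self_sqrt hc.le
    have hs' : √c ≠ 0 := (Real.sqrt_pos.mpr hc).ne'
    convert h1 using 1
    simp [fromBlocks_conjTranspose, fromBlocks_multiply, conjTranspose_smul, smul_smul, hs, hs',
      ← mul_inv, ← smul_sub, partialTransposeB_smul]

end Dual

section DualTensor

variable {A₀ B₀ A₁ B₁ : Type*} [Fintype A₀] [Fintype B₀] [Fintype A₁] [Fintype B₁]
  [DecidableEq A₀] [DecidableEq B₀] [DecidableEq A₁] [DecidableEq B₁]

/-- Dual feasible points multiply: the multipliers are combined so that `Q + R` and `Q - R` are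
both multiplicative. -/
lemma IsDualFeasible.bipartiteTensor {Y₀ Q₀ R₀ : Matrix (A₀ × B₀) (A₀ × B₀) ℂ}
    {Y₁ Q₁ R₁ : Matrix (A₁ × B₁) (A₁ × B₁) ℂ} {μ₀ μ₁ : ℝ}
    (h₀ : IsDualFeasible Y₀ Q₀ R₀ μ₀) (h₁ : IsDualFeasible Y₁ Q₁ R₁ μ₁) :
    IsDualFeasible (bipartiteTensor Y₀ Y₁)
      (bipartiteTensor Q₀ Q₁ + bipartiteTensor R₀ R₁)
      (bipartiteTensor Q₀ R₁ + bipartiteTensor R₀ Q₁) (μ₀ * μ₁) := by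
  refine ⟨mul_nonneg h₀.nonneg h₁.nonneg,
    add_nonneg (bipartiteTensor_nonneg h₀.nonneg_left h₁.nonneg_left)
      (bipartiteTensor_nonneg h₀.nonneg_right h₁.nonneg_right),
    add_nonneg (bipartiteTensor_nonneg h₀.nonneg_left h₁.nonneg_right)
      (bipartiteTensor_nonneg h₀.nonneg_right h₁.nonneg_left), ?_, ?_⟩
  · have h := bipartiteTensor_mem_Icc h₀.mem_Icc h₁.mem_Icc
    rw [smul_bipartiteTensor, bipartiteTensor_smul, bipartiteTensor_one, smul_smul,
      ← partialTransposeB_bipartiteTensor] at h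
    convert h using 2
    simp only [bipartiteTensor_add, add_bipartiteTensor]
    abel
  · have h := posSemidef_fromBlocks_bipartiteTensor h₀.posSemidef h₁.posSemidef
    rw [bipartiteTensor_one, ← partialTransposeB_bipartiteTensor] at h
    convert h using 3
    simp only [bipartiteTensor_sub, sub_bipartiteTensor]
    abel

end DualTensor

/-! ### Strong duality -/

section Separation

/-- A point whose nonnegative multiples avoid a compact convex set is weakly separated from it by
a functional that is positive on the set. -/
lemma exists_pos_on_of_ray_disjoint {F : Type*} [AddCommGroup F] [Module ℝ F] [TopologicalSpace F]
    [IsTopologicalAddGroup F] [ContinuousSMul ℝ F] [LocallyConvexSpace ℝ F] [T2Space F]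
    {S : Set F}
    (hS : Convex ℝ S) (hc : IsCompact S) {p : F} (hp : ∀ s : ℝ, 0 ≤ s → s • p ∉ S) :
    ∃ g : F →L[ℝ] ℝ, (∀ b ∈ S, 0 < g b) ∧ g p ≤ 0 := by
  let L : ℝ →ₗ[ℝ] F := LinearMap.toSpanSingleton ℝ F p
  have hconv : Convex ℝ (L '' Set.Ici 0) := (convex_Ici 0).linear_image L
  have hclosed : IsClosed (L '' Set.Ici 0) := by
    by_cases h0 : p = 0
    · have : L '' Set.Ici 0 = {0} := by
        ext x
        simp only [Set.mem_image, Set.mem_singleton_iff]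
        constructor
        · rintro ⟨s, -, rfl⟩; simp [L, h0]
        · rintro rfl; exact ⟨0, by simp, by simp⟩
      rw [this]; exact isClosed_singleton
    · have hinj : Function.Injective L := smul_left_injective ℝ h0
      exact (LinearMap.isClosedEmbedding_of_injective
        (LinearMap.ker_eq_bot.mpr hinj)).isClosedMap _ isClosed_Ici
  have hdis : Disjoint S (L '' Set.Ici 0) := by
    rw [Set.disjoint_left]
    rintro _ hx ⟨s, hs, rfl⟩
    exact hp s hs hx
  obtain ⟨f, u, v, h1, h2, h3⟩ := geometric_hahn_banach_compact_closed hS hc hconv hclosed hdis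
  have hv : v < 0 := by simpa using h3 0 ⟨0, by simp, by simp⟩
  refine ⟨-f, fun b hb => by have := h1 b hb; simp; linarith, ?_⟩
  -- A linear functional bounded below on a ray is nonnegative there.
  by_contra! hlt
  have hfp : f p < 0 := by simpa using hlt
  have := h3 ((v / f p) • p) ⟨v / f p, div_nonneg_of_nonpos hv.le hfp.le, rfl⟩
  rw [map_smul, smul_eq_mul, div_mul_cancel₀ _ hfp.ne] at this
  exact lt_irrefl _ this

end Separation

section Cone

variable (A B : Type*)

/-- The tuples `(P, M, N, S, S')` of matrices made of the primal block matrix `P`, the primal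
variables `M` and `N`, and slack variables for the two inequalities on the partial transpose. -/
abbrev SDPVars : Type _ :=
  Matrix ((A × B) ⊕ (A × B)) ((A × B) ⊕ (A × B)) ℂ × Matrix (A × B) (A × B) ℂ ×
    Matrix (A × B) (A × B) ℂ × Matrix (A × B) (A × B) ℂ × Matrix (A × B) (A × B) ℂ

/-- The target space of the constraints and the objective of the semidefinite program. -/
abbrev SDPValues : Type _ :=
  Matrix (A × B) (A × B) ℂ × Matrix (A × B) (A × B) ℂ × Matrix (A × B) (A × B) ℂ × ℝ × ℝ

variable {A B} [Fintype A] [Fintype B]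

/-- The constraints of the semidefinite program in equality form, followed by the objective. -/
noncomputable def sdpMap : SDPVars A B →ₗ[ℝ] SDPValues A B where
  toFun x := (x.1.toBlocks₁₁,
    partialTransposeB x.1.toBlocks₂₂ - partialTransposeB (x.2.1 - x.2.2.1) + x.2.2.2.1,
    -partialTransposeB x.1.toBlocks₂₂ - partialTransposeB (x.2.1 - x.2.2.1) + x.2.2.2.2,
    (x.2.1 + x.2.2.1).trace.re, x.1.toBlocks₁₂.trace.re)
  map_add' x y := by
    refine Prod.ext rfl (Prod.ext ?_ (Prod.ext ?_ (Prod.ext ?_ ?_)))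
    · ext; simp [partialTransposeB, toBlocks₂₂]; ring
    · ext; simp [partialTransposeB, toBlocks₂₂]; ring
    · simp [trace_add]; ring
    · simp [Matrix.trace, toBlocks₁₂, Finset.sum_add_distrib]
  map_smul' c x := by
    refine Prod.ext rfl (Prod.ext ?_ (Prod.ext ?_ (Prod.ext ?_ ?_)))
    · ext; simp [partialTransposeB, toBlocks₂₂]; ring
    · ext; simp [partialTransposeB, toBlocks₂₂]; ring
    · simp [trace_add]; ring
    · simp [Matrix.trace, toBlocks₁₂, Finset.mul_sum]

variable (A B) in
/-- The cone of tuples of positive semidefinite matrices. -/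
def sdpCone : Set (SDPVars A B) :=
  {x | 0 ≤ x.1 ∧ 0 ≤ x.2.1 ∧ 0 ≤ x.2.2.1 ∧ 0 ≤ x.2.2.2.1 ∧ 0 ≤ x.2.2.2.2}

/-- The sum of the traces of the components. -/
def sdpTrace (x : SDPVars A B) : ℝ :=
  x.1.trace.re + x.2.1.trace.re + x.2.2.1.trace.re + x.2.2.2.1.trace.re + x.2.2.2.2.trace.re

lemma smul_mem_sdpCone {x : SDPVars A B} (hx : x ∈ sdpCone A B) {c : ℝ} (hc : 0 ≤ c) :
    c • x ∈ sdpCone A B :=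
  ⟨smul_nonneg hc hx.1, smul_nonneg hc hx.2.1, smul_nonneg hc hx.2.2.1, smul_nonneg hc hx.2.2.2.1,
    smul_nonneg hc hx.2.2.2.2⟩

lemma re_trace_nonneg {n : Type*} [Fintype n] {X : Matrix n n ℂ} (h : 0 ≤ X) :
    0 ≤ X.trace.re := (Complex.le_def.mp h.posSemidef.trace_nonneg).1

lemma eq_zero_of_re_trace_eq_zero {n : Type*} [Fintype n] {X : Matrix n n ℂ} (h : 0 ≤ X)
    (ht : X.trace.re = 0) : X = 0 := by
  rw [← h.posSemidef.trace_eq_zero_iff]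
  exact Complex.ext ht (Complex.le_def.mp h.posSemidef.trace_nonneg).2.symm

lemma sdpTrace_pos {x : SDPVars A B} (hx : x ∈ sdpCone A B) (h : x ≠ 0) : 0 < sdpTrace x := by
  obtain ⟨h1, h2, h3, h4, h5⟩ := hx
  have t1 := re_trace_nonneg h1
  have t2 := re_trace_nonneg h2
  have t3 := re_trace_nonneg h3
  have t4 := re_trace_nonneg h4
  have t5 := re_trace_nonneg h5
  have h0 : 0 ≤ sdpTrace x := by unfold sdpTrace; positivity
  refine h0.lt_of_ne fun h' => h ?_
  unfold sdpTrace at h'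
  exact Prod.ext (eq_zero_of_re_trace_eq_zero h1 (by linarith))
    (Prod.ext (eq_zero_of_re_trace_eq_zero h2 (by linarith))
    (Prod.ext (eq_zero_of_re_trace_eq_zero h3 (by linarith))
    (Prod.ext (eq_zero_of_re_trace_eq_zero h4 (by linarith))
      (eq_zero_of_re_trace_eq_zero h5 (by linarith)))))

lemma sdpTrace_smul (c : ℝ) (x : SDPVars A B) : sdpTrace (c • x) = c * sdpTrace x := by
  simp [sdpTrace]; ring

lemma sdpTrace_add (x y : SDPVars A B) : sdpTrace (x + y) = sdpTrace x + sdpTrace y := by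
  simp [sdpTrace]; ring

lemma convex_sdpBase : Convex ℝ {x ∈ sdpCone A B | sdpTrace x = 1} := by
  rintro x ⟨hx, hx1⟩ y ⟨hy, hy1⟩ a b ha hb hab
  have hx' := smul_mem_sdpCone hx ha
  have hy' := smul_mem_sdpCone hy hb
  refine ⟨⟨add_nonneg hx'.1 hy'.1, add_nonneg hx'.2.1 hy'.2.1, add_nonneg hx'.2.2.1 hy'.2.2.1,
    add_nonneg hx'.2.2.2.1 hy'.2.2.2.1, add_nonneg hx'.2.2.2.2 hy'.2.2.2.2⟩, ?_⟩
  rw [sdpTrace_add, sdpTrace_smul, sdpTrace_smul, hx1, hy1, mul_one, mul_one, hab]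

open scoped Matrix.Norms.L2Operator in
lemma isCompact_sdpBase [DecidableEq A] [DecidableEq B] : IsCompact {x ∈ sdpCone A B | sdpTrace x = 1} := by
  have h := isCompact_posSemidef_trace_le (n := A × B) 1
  have hK := (isCompact_posSemidef_trace_le (n := (A × B) ⊕ (A × B)) 1).prod
    (h.prod (h.prod (h.prod h)))
  have hC : IsClosed {x : SDPVars A B | sdpTrace x = 1} := by
    unfold sdpTrace
    exact isClosed_eq (by fun_prop) continuous_const
  convert hK.inter_right hC using 1
  ext x
  constructor
  · rintro ⟨⟨h1, h2, h3, h4, h5⟩, hx⟩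
    have t1 := re_trace_nonneg h1
    have t2 := re_trace_nonneg h2
    have t3 := re_trace_nonneg h3
    have t4 := re_trace_nonneg h4
    have t5 := re_trace_nonneg h5
    refine ⟨⟨⟨h1, ?_⟩, ⟨h2, ?_⟩, ⟨h3, ?_⟩, ⟨h4, ?_⟩, h5, ?_⟩, hx⟩ <;>
      (unfold sdpTrace at hx; linarith)
  · rintro ⟨⟨⟨h1, -⟩, ⟨h2, -⟩, ⟨h3, -⟩, ⟨h4, -⟩, h5, -⟩, hx⟩
    exact ⟨⟨h1, h2, h3, h4, h5⟩, hx⟩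

lemma trace_eq_trace_toBlocks {n : Type*} [Fintype n] (P : Matrix (n ⊕ n) (n ⊕ n) ℂ) :
    P.trace = P.toBlocks₁₁.trace + P.toBlocks₂₂.trace := by
  simp [Matrix.trace, toBlocks₁₁, toBlocks₂₂]

lemma toBlocks₁₁_nonneg {n : Type*} [Fintype n] {P : Matrix (n ⊕ n) (n ⊕ n) ℂ} (h : 0 ≤ P) :
    0 ≤ P.toBlocks₁₁ := (h.posSemidef.submatrix Sum.inl).nonneg

lemma toBlocks₂₂_nonneg {n : Type*} [Fintype n] {P : Matrix (n ⊕ n) (n ⊕ n) ℂ} (h : 0 ≤ P) :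
    0 ≤ P.toBlocks₂₂ := (h.posSemidef.submatrix Sum.inr).nonneg

lemma fromBlocks_toBlocks_of_nonneg {n : Type*} [Fintype n]
    {P : Matrix (n ⊕ n) (n ⊕ n) ℂ} (h : 0 ≤ P) :
    fromBlocks P.toBlocks₁₁ P.toBlocks₁₂ P.toBlocks₁₂ᴴ P.toBlocks₂₂ = P := by
  have h21 : P.toBlocks₁₂ᴴ = P.toBlocks₂₁ := by
    ext i j
    exact h.posSemidef.isHermitian.apply (Sum.inr i) (Sum.inl j)
  rw [h21, fromBlocks_toBlocks]

/-- Nonzero elements of the cone are not mapped to zero: the constraints with zero right-hand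
sides force all traces to vanish. -/
lemma sdpMap_ne_zero {x : SDPVars A B} (hx : x ∈ sdpCone A B) (h : x ≠ 0) : sdpMap x ≠ 0 := by
  intro h0
  have hpos := sdpTrace_pos hx h
  obtain ⟨h1, h2, h3, h4, h5⟩ := hx
  have e1 : x.1.toBlocks₁₁.trace.re = 0 := by
    rw [show x.1.toBlocks₁₁ = 0 from congrArg Prod.fst h0]; simp
  have e2 := congrArg (fun y => y.2.1.trace.re) h0
  have e3 := congrArg (fun y => y.2.2.1.trace.re) h0
  have e4 := congrArg (fun y => y.2.2.2.1) h0
  simp only [sdpMap, LinearMap.coe_mk, AddHom.coe_mk, trace_add, trace_sub, trace_neg,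
    trace_partialTransposeB, Complex.add_re, Complex.sub_re, Complex.neg_re, Prod.snd_zero,
    Prod.fst_zero, trace_zero, Complex.zero_re] at e2 e3 e4
  have t1 := re_trace_nonneg (toBlocks₂₂_nonneg h1)
  have t2 := re_trace_nonneg h2
  have t3 := re_trace_nonneg h3
  have t4 := re_trace_nonneg h4
  have t5 := re_trace_nonneg h5
  rw [sdpTrace, trace_eq_trace_toBlocks, Complex.add_re] at hpos
  linarith

lemma mem_sdpValues_of_sdpMap_eq [DecidableEq A] [DecidableEq B] {ρ : Matrix (A × B) (A × B) ℂ} {x : SDPVars A B}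
    (hx : x ∈ sdpCone A B) {c : ℝ} (h : sdpMap x = (ρ, 0, 0, 1, -c)) : c ∈ sdpValues ρ := by
  obtain ⟨h1, h2, h3, h4, h5⟩ := hx
  have e1 : x.1.toBlocks₁₁ = ρ := congrArg Prod.fst h
  have e2 := congrArg (fun y => y.2.1) h
  have e3 := congrArg (fun y => y.2.2.1) h
  have e4 := congrArg (fun y => y.2.2.2.1) h
  have e5 := congrArg (fun y => y.2.2.2.2) h
  simp only [sdpMap, LinearMap.coe_mk, AddHom.coe_mk] at e2 e3 e4 e5
  have hP : (fromBlocks ρ x.1.toBlocks₁₂ x.1.toBlocks₁₂ᴴ x.1.toBlocks₂₂).PosSemidef := by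
    rw [← e1, fromBlocks_toBlocks_of_nonneg h1]; exact h1.posSemidef
  have hP' := hP.fromBlocks_phase (c := -1) (by simp)
  refine ⟨_, x.1.toBlocks₂₂, x.2.1, x.2.2.1, h2, h3, ?_, ?_, ?_, hP', ?_⟩
  · rw [← sub_nonneg]
    convert h5 using 1
    rw [← sub_eq_zero, ← neg_eq_zero, ← e3, partialTransposeB_sub]; abel
  · rw [← sub_nonneg]
    convert h4 using 1
    rw [← sub_eq_zero, ← neg_eq_zero, ← e2, partialTransposeB_sub]; abel
  · refine Complex.le_def.mpr ⟨e4.le, ?_⟩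
    exact (Complex.le_def.mp (add_nonneg h2 h3).posSemidef.trace_nonneg).2.symm
  · rw [re_trace_add_conjTranspose_div_two, trace_smul, neg_one_smul, Complex.neg_re, e5, neg_neg]

end Cone

section StrongDuality

variable {A B : Type*} [Fintype A] [Fintype B] [DecidableEq A] [DecidableEq B]

lemma posSemidef_fromBlocks_zero {n : Type*} [Fintype n] [DecidableEq n] {ρ : Matrix n n ℂ}
    (hρ : 0 ≤ ρ) : (fromBlocks ρ 0 0 (0 : Matrix n n ℂ)).PosSemidef := by
  have h := hρ.posSemidef.mul_mul_conjTranspose_same (fromRows 1 0 : Matrix (n ⊕ n) n ℂ)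
  have he : fromBlocks ρ 0 0 (0 : Matrix n n ℂ) =
      (fromRows 1 0 : Matrix (n ⊕ n) n ℂ) * ρ * (fromRows 1 0 : Matrix (n ⊕ n) n ℂ)ᴴ := by
    ext (i | i) (j | j) <;>
      simp [conjTranspose_fromRows_eq_fromCols_conjTranspose, fromRows_mul]
  rw [he]
  exact h

lemma zero_mem_sdpValues {ρ : Matrix (A × B) (A × B) ℂ} (hρ : 0 ≤ ρ) : 0 ∈ sdpValues ρ := by
  refine ⟨0, 0, 0, 0, le_rfl, le_rfl, by simp, by simp, by simp, ?_, by simp⟩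
  simpa using posSemidef_fromBlocks_zero hρ

lemma sdpFidelity_nonneg {ρ : Matrix (A × B) (A × B) ℂ} (hρ : IsDensity ρ) :
    0 ≤ sdpFidelity ρ :=
  (isGreatest_sdpValues hρ).2 (zero_mem_sdpValues hρ.1.nonneg)

open scoped Matrix.Norms.L2Operator in
/-- Strong duality: every bound above the optimal value is certified by a dual feasible point. -/
theorem exists_isDualFeasible_of_sdpFidelity_lt {ρ : Matrix (A × B) (A × B) ℂ} (hρ : IsDensity ρ)
    {c : ℝ} (hc : sdpFidelity ρ < c) :
    ∃ Y Q R μ, IsDualFeasible Y Q R μ ∧ 0 ≤ Y ∧ (Y * ρ).trace.re + μ ≤ 2 * c := by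
  have hc0 : 0 < c := (sdpFidelity_nonneg hρ).trans_lt hc
  -- Feasible objective values are symmetric about zero, so `-c` is unattainable as well; this sign
  -- makes the multiplier of the objective positive.
  have hray : ∀ s : ℝ, 0 ≤ s → s • ((ρ, 0, 0, 1, -c) : SDPValues A B) ∉
      sdpMap '' {x ∈ sdpCone A B | sdpTrace x = 1} := by
    rintro s hs ⟨x, ⟨hx, hx1⟩, hxs⟩
    have hx0 : x ≠ 0 := by
      rintro rfl
      simp [sdpTrace] at hx1
    rcases hs.eq_or_lt with rfl | hs
    · exact sdpMap_ne_zero hx hx0 (by rw [hxs, zero_smul])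
    · have h1 : sdpMap (s⁻¹ • x) = (ρ, 0, 0, 1, -c) := by
        rw [map_smul, hxs, smul_smul, inv_mul_cancel₀ hs.ne', one_smul]
      have h2 := mem_sdpValues_of_sdpMap_eq (smul_mem_sdpCone hx (by positivity)) h1
      exact absurd ((isGreatest_sdpValues hρ).2 h2) (not_le.mpr hc)
  have hcont : Continuous (sdpMap : SDPVars A B →ₗ[ℝ] SDPValues A B) :=
    LinearMap.continuous_of_finiteDimensional _
  obtain ⟨g, hg, hgp⟩ := exists_pos_on_of_ray_disjoint
    (convex_sdpBase.linear_image sdpMap) (isCompact_sdpBase.image hcont) hray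
  have hpos : ∀ x ∈ sdpCone A B, x ≠ 0 → 0 < g (sdpMap x) := by
    intro x hx h0
    have ht := sdpTrace_pos hx h0
    have := hg _ ⟨(sdpTrace x)⁻¹ • x, ⟨smul_mem_sdpCone hx (by positivity), by
      rw [sdpTrace_smul, inv_mul_cancel₀ ht.ne']⟩, rfl⟩
    rw [map_smul, map_smul, smul_eq_mul] at this
    exact pos_of_mul_pos_right this (by positivity)
  have hnn : ∀ x ∈ sdpCone A B, 0 ≤ g (sdpMap x) := by
    intro x hx
    by_cases h0 : x = 0
    · simp [h0]
    · exact (hpos x hx h0).le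
  obtain ⟨Y, hY, hgY⟩ := exists_isHermitian_re_trace_mul_eq
    { toFun := fun X => g (X, 0, 0, 0, 0)
      map_add' := fun X X' => by rw [← map_add]; simp
      map_smul' := fun r X => by rw [RingHom.id_apply, ← map_smul]; simp }
  obtain ⟨Q, hQ, hgQ⟩ := exists_isHermitian_re_trace_mul_eq
    { toFun := fun X => g (0, X, 0, 0, 0)
      map_add' := fun X X' => by rw [← map_add]; simp
      map_smul' := fun r X => by rw [RingHom.id_apply, ← map_smul]; simp }
  obtain ⟨R, hR, hgR⟩ := exists_isHermitian_re_trace_mul_eq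
    { toFun := fun X => g (0, 0, X, 0, 0)
      map_add' := fun X X' => by rw [← map_add]; simp
      map_smul' := fun r X => by rw [RingHom.id_apply, ← map_smul]; simp }
  set m : ℝ := g (0, 0, 0, 1, 0) with hm
  set t : ℝ := g (0, 0, 0, 0, 1) with ht
  simp only [LinearMap.coe_mk, AddHom.coe_mk] at hgY hgQ hgR
  have hgeq : ∀ X Z W : Matrix (A × B) (A × B) ℂ, X.IsHermitian → Z.IsHermitian → W.IsHermitian →
      ∀ a b : ℝ, g (X, Z, W, a, b) =
        (Y * X).trace.re + (Q * Z).trace.re + (R * W).trace.re + a * m + b * t := by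
    intro X Z W hX hZ hW a b
    rw [← hgY X hX, ← hgQ Z hZ, ← hgR W hW, hm, ht, ← smul_eq_mul, ← smul_eq_mul, ← map_smul,
      ← map_smul, ← map_add, ← map_add, ← map_add, ← map_add]
    simp
  have key : ∀ P M N S S', (P, M, N, S, S') ∈ sdpCone A B →
      g (sdpMap (P, M, N, S, S')) = (Y * P.toBlocks₁₁).trace.re +
        (Q * (partialTransposeB P.toBlocks₂₂ - partialTransposeB (M - N) + S)).trace.re +
        (R * (-partialTransposeB P.toBlocks₂₂ - partialTransposeB (M - N) + S')).trace.re +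
        (M + N).trace.re * m + P.toBlocks₁₂.trace.re * t := by
    rintro P M N S S' ⟨hP, hM, hN, hS, hS'⟩
    have h22 := isHermitian_partialTransposeB (toBlocks₂₂_nonneg hP).posSemidef.isHermitian
    have hMN := isHermitian_partialTransposeB
      (hM.posSemidef.isHermitian.sub hN.posSemidef.isHermitian)
    exact hgeq _ _ _ (toBlocks₁₁_nonneg hP).posSemidef.isHermitian
      ((h22.sub hMN).add hS.posSemidef.isHermitian)
      ((h22.neg.sub hMN).add hS'.posSemidef.isHermitian) _ _
  have z11 : (0 : Matrix ((A × B) ⊕ (A × B)) ((A × B) ⊕ (A × B)) ℂ).toBlocks₁₁ = 0 := rfl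
  have z12 : (0 : Matrix ((A × B) ⊕ (A × B)) ((A × B) ⊕ (A × B)) ℂ).toBlocks₁₂ = 0 := rfl
  have z22 : (0 : Matrix ((A × B) ⊕ (A × B)) ((A × B) ⊕ (A × B)) ℂ).toBlocks₂₂ = 0 := rfl
  -- Positivity on the individual factors of the cone yields the dual constraints.
  have hQ0 : 0 ≤ Q := nonneg_of_forall_re_trace_mul_nonneg hQ fun S hS => by
    have hx : (0, 0, 0, S, 0) ∈ sdpCone A B := ⟨le_rfl, le_rfl, le_rfl, hS, le_rfl⟩
    have h := hnn _ hx
    rw [key _ _ _ _ _ hx] at h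
    simpa [z11, z12, z22] using h
  have hR0 : 0 ≤ R := nonneg_of_forall_re_trace_mul_nonneg hR fun S hS => by
    have hx : (0, 0, 0, 0, S) ∈ sdpCone A B := ⟨le_rfl, le_rfl, le_rfl, le_rfl, hS⟩
    have h := hnn _ hx
    rw [key _ _ _ _ _ hx] at h
    simpa [z11, z12, z22] using h
  have hQR := isHermitian_partialTransposeB (hQ.add hR)
  have h1 : (m • (1 : Matrix (A × B) (A × B) ℂ)).IsHermitian := by
    simp [IsHermitian, conjTranspose_smul]
  have hle : partialTransposeB (Q + R) ≤ m • 1 := by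
    rw [← sub_nonneg]
    refine nonneg_of_forall_re_trace_mul_nonneg (h1.sub hQR) fun M hM => ?_
    have hx : (0, M, 0, 0, 0) ∈ sdpCone A B := ⟨le_rfl, hM, le_rfl, le_rfl, le_rfl⟩
    have h := hnn _ hx
    rw [key _ _ _ _ _ hx] at h
    simp [z11, z12, z22] at h
    simp [sub_mul, trace_partialTransposeB_mul, add_mul]
    linarith
  have hge : -(m • 1) ≤ partialTransposeB (Q + R) := by
    rw [← sub_nonneg]
    refine nonneg_of_forall_re_trace_mul_nonneg (hQR.sub h1.neg) fun N hN => ?_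
    have hx : (0, 0, N, 0, 0) ∈ sdpCone A B := ⟨le_rfl, le_rfl, hN, le_rfl, le_rfl⟩
    have h := hnn _ hx
    rw [key _ _ _ _ _ hx] at h
    simp [z11, z12, z22, partialTransposeB_neg] at h
    simp [trace_partialTransposeB_mul, add_mul]
    linarith
  have hHerm : (fromBlocks Y ((t / 2) • 1) ((t / 2) • 1)
      (partialTransposeB (Q - R))).IsHermitian := by
    rw [IsHermitian, fromBlocks_conjTranspose, hY.eq,
      (isHermitian_partialTransposeB (hQ.sub hR)).eq]
    simp [conjTranspose_smul]
  have hblock : 0 ≤ fromBlocks Y ((t / 2) • 1) ((t / 2) • 1) (partialTransposeB (Q - R)) := by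
    refine nonneg_of_forall_re_trace_mul_nonneg hHerm fun P hP => ?_
    have hx : (P, 0, 0, 0, 0) ∈ sdpCone A B := ⟨hP, le_rfl, le_rfl, le_rfl, le_rfl⟩
    have h := hnn _ hx
    rw [key _ _ _ _ _ hx] at h
    rw [← fromBlocks_toBlocks_of_nonneg hP, trace_fromBlocks_mul_fromBlocks,
      trace_partialTransposeB_mul]
    simp [sub_mul] at h ⊢
    linarith
  -- The tuple `(ρ ⊕ 0, ρ / 2, ρ / 2, 0, 0)` is feasible with objective zero.
  have hhalf : 0 ≤ (1 / 2 : ℝ) • ρ := smul_nonneg (by norm_num) hρ.1.nonneg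
  have hx : (fromBlocks ρ 0 0 0, (1 / 2 : ℝ) • ρ, (1 / 2 : ℝ) • ρ, 0, 0) ∈ sdpCone A B :=
    ⟨(posSemidef_fromBlocks_zero hρ.1.nonneg).nonneg, hhalf, hhalf, le_rfl, le_rfl⟩
  have hρ0 : ρ ≠ 0 := by
    rintro rfl
    simpa using hρ.2
  have hYm : 0 < (Y * ρ).trace.re + m := by
    have h := hpos _ hx fun h => hρ0 (by simpa [z11] using congrArg (fun y => y.1.toBlocks₁₁) h)
    rw [key _ _ _ _ _ hx, ← add_smul, sub_self] at h
    norm_num [hρ.2] at h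
    exact h
  have hm0 : 0 ≤ m := by
    have hx' : (0, (1 / 2 : ℝ) • ρ, (1 / 2 : ℝ) • ρ, 0, 0) ∈ sdpCone A B :=
      ⟨le_rfl, hhalf, hhalf, le_rfl, le_rfl⟩
    have h := hnn _ hx'
    rw [key _ _ _ _ _ hx', ← add_smul, sub_self] at h
    norm_num [hρ.2, z11, z12, z22] at h
    exact h
  rw [hgeq _ _ _ hρ.1.isHermitian isHermitian_zero isHermitian_zero] at hgp
  simp only [mul_zero, trace_zero, Complex.zero_re, add_zero, one_mul] at hgp
  have ht0 : 0 < t := by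
    by_contra! hle
    nlinarith
  -- Normalise the multiplier of the objective to `2`.
  have hs : (0 : ℝ) ≤ 2 / t := by positivity
  have hblock' := smul_nonneg hs hblock
  rw [fromBlocks_smul, smul_smul, div_mul_div_cancel₀ ht0.ne', div_self two_ne_zero,
    one_smul] at hblock'
  refine ⟨(2 / t) • Y, (2 / t) • Q, (2 / t) • R, 2 / t * m, ⟨mul_nonneg hs hm0,
    smul_nonneg hs hQ0, smul_nonneg hs hR0, ⟨?_, ?_⟩, ?_⟩, ?_, ?_⟩
  · have := smul_le_smul_of_nonneg_left hge hs
    rwa [smul_neg, smul_smul, ← partialTransposeB_smul, smul_add] at this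
  · have := smul_le_smul_of_nonneg_left hle hs
    rwa [smul_smul, ← partialTransposeB_smul, smul_add] at this
  · rw [← smul_sub, partialTransposeB_smul]
    exact hblock'.posSemidef
  · exact toBlocks₁₁_nonneg hblock'
  · rw [smul_mul_assoc, trace_smul, Complex.real_smul, Complex.re_ofReal_mul, ← mul_add,
      div_mul_eq_mul_div, div_le_iff₀ ht0]
    linarith

end StrongDuality

/-! ### Multiplicativity of the optimal value -/

section Multiplicativity

variable {A₀ B₀ A₁ B₁ : Type*} [Fintype A₀] [Fintype B₀] [Fintype A₁] [Fintype B₁]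
  [DecidableEq A₀] [DecidableEq B₀] [DecidableEq A₁] [DecidableEq B₁]

/-- Primal feasible points multiply, and a phase makes the trace of the off-diagonal block of the
product nonnegative. -/
lemma sdpFidelity_mul_le {ρ₀ : Matrix (A₀ × B₀) (A₀ × B₀) ℂ} {ρ₁ : Matrix (A₁ × B₁) (A₁ × B₁) ℂ}
    (hρ₀ : IsDensity ρ₀) (hρ₁ : IsDensity ρ₁) :
    sdpFidelity ρ₀ * sdpFidelity ρ₁ ≤ sdpFidelity (bipartiteTensor ρ₀ ρ₁) := by
  obtain ⟨X₀, σ₀, M₀, N₀, hM₀, hN₀, hl₀, hu₀, ht₀, hP₀, hv₀⟩ := (isGreatest_sdpValues hρ₀).1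
  obtain ⟨X₁, σ₁, M₁, N₁, hM₁, hN₁, hl₁, hu₁, ht₁, hP₁, hv₁⟩ := (isGreatest_sdpValues hρ₁).1
  rw [re_trace_add_conjTranspose_div_two] at hv₀ hv₁
  obtain ⟨c, hc, hcX⟩ := RCLike.exists_norm_eq_mul_self (bipartiteTensor X₀ X₁).trace
  have hmem : ‖(bipartiteTensor X₀ X₁).trace‖ ∈ sdpValues (bipartiteTensor ρ₀ ρ₁) := by
    have hI := bipartiteTensor_mem_Icc
      (X₀ := partialTransposeB σ₀) (S₀ := partialTransposeB (M₀ - N₀))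
      (X₁ := partialTransposeB σ₁) (S₁ := partialTransposeB (M₁ - N₁))
      ⟨by simpa [partialTransposeB_sub, neg_add_eq_sub] using hl₀, hu₀⟩
      ⟨by simpa [partialTransposeB_sub, neg_add_eq_sub] using hl₁, hu₁⟩
    rw [← partialTransposeB_bipartiteTensor, ← partialTransposeB_bipartiteTensor] at hI
    have hsub : bipartiteTensor (M₀ - N₀) (M₁ - N₁) =
        (bipartiteTensor M₀ M₁ + bipartiteTensor N₀ N₁) -
          (bipartiteTensor M₀ N₁ + bipartiteTensor N₀ M₁) := by
      simp only [bipartiteTensor_sub, sub_bipartiteTensor]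
      abel
    have hadd : (bipartiteTensor M₀ M₁ + bipartiteTensor N₀ N₁) +
        (bipartiteTensor M₀ N₁ + bipartiteTensor N₀ M₁) =
          bipartiteTensor (M₀ + N₀) (M₁ + N₁) := by
      simp only [bipartiteTensor_add, add_bipartiteTensor]
      abel
    rw [hsub, partialTransposeB_sub] at hI
    have hP := posSemidef_fromBlocks_bipartiteTensor hP₀ hP₁
    rw [← bipartiteTensor_conjTranspose] at hP
    refine ⟨_, bipartiteTensor σ₀ σ₁, _, _,
      add_nonneg (bipartiteTensor_nonneg hM₀ hM₁) (bipartiteTensor_nonneg hN₀ hN₁),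
      add_nonneg (bipartiteTensor_nonneg hM₀ hN₁) (bipartiteTensor_nonneg hN₀ hM₁),
      ?_, hI.2, ?_, hP.fromBlocks_phase hc, ?_⟩
    · rw [neg_add_eq_sub, ← neg_sub]; exact hI.1
    · rw [hadd, trace_bipartiteTensor]
      exact mul_le_one₀ ht₀ (add_nonneg hM₁ hN₁).posSemidef.trace_nonneg ht₁
    · rw [re_trace_add_conjTranspose_div_two, trace_smul, smul_eq_mul, ← hcX]
      simp
  refine le_trans ?_ ((isGreatest_sdpValues (hρ₀.bipartiteTensor hρ₁)).2 hmem)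
  rw [trace_bipartiteTensor, norm_mul, hv₀, hv₁]
  refine mul_le_mul (Complex.re_le_norm _) (Complex.re_le_norm _) ?_ (norm_nonneg _)
  rw [← hv₁]
  exact sdpFidelity_nonneg hρ₁

lemma sq_le_mul_of_forall_two_mul_le {a m v : ℝ} (hm : 0 ≤ m) (hv : 0 ≤ v) (ha : 0 ≤ a)
    (h : ∀ c : ℝ, 0 < c → 2 * v ≤ c * a + c⁻¹ * m) : v ^ 2 ≤ a * m := by
  have hq : ∀ c : ℝ, 0 ≤ a * (c * c) + (-(2 * v)) * c + m := by
    intro c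
    rcases le_or_gt c 0 with hc | hc
    · nlinarith [mul_nonneg ha (mul_self_nonneg c), mul_nonneg hv (neg_nonneg.mpr hc)]
    · have h1 := mul_le_mul_of_nonneg_left (h c hc) hc.le
      have h2 : c * (c⁻¹ * m) = m := by rw [← mul_assoc, mul_inv_cancel₀ hc.ne', one_mul]
      nlinarith
  have := discrim_le_zero hq
  rw [discrim] at this
  nlinarith

/-- Dual feasible points multiply; optimising over the rescalings of the product certificate
replaces the sum of its two dual terms by twice their geometric mean. -/
lemma sdpFidelity_le_mul {ρ₀ : Matrix (A₀ × B₀) (A₀ × B₀) ℂ} {ρ₁ : Matrix (A₁ × B₁) (A₁ × B₁) ℂ}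
    (hρ₀ : IsDensity ρ₀) (hρ₁ : IsDensity ρ₁) {c₀ c₁ : ℝ} (hc₀ : sdpFidelity ρ₀ < c₀)
    (hc₁ : sdpFidelity ρ₁ < c₁) : sdpFidelity (bipartiteTensor ρ₀ ρ₁) ≤ c₀ * c₁ := by
  obtain ⟨Y₀, Q₀, R₀, μ₀, h₀, hY₀, hle₀⟩ := exists_isDualFeasible_of_sdpFidelity_lt hρ₀ hc₀
  obtain ⟨Y₁, Q₁, R₁, μ₁, h₁, hY₁, hle₁⟩ := exists_isDualFeasible_of_sdpFidelity_lt hρ₁ hc₁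
  have hp₀ : 0 ≤ c₀ := (sdpFidelity_nonneg hρ₀).trans hc₀.le
  have hp₁ : 0 ≤ c₁ := (sdpFidelity_nonneg hρ₁).trans hc₁.le
  have hρ := hρ₀.bipartiteTensor hρ₁
  have ha₀ := re_trace_mul_nonneg hY₀ hρ₀.1.nonneg
  have ha₁ := re_trace_mul_nonneg hY₁ hρ₁.1.nonneg
  set a₀ := (Y₀ * ρ₀).trace.re
  set a₁ := (Y₁ * ρ₁).trace.re
  have htr : (bipartiteTensor Y₀ Y₁ * bipartiteTensor ρ₀ ρ₁).trace.re = a₀ * a₁ := by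
    have him := (Complex.le_def.mp (trace_mul_nonneg_of_nonneg hY₀ hρ₀.1.nonneg)).2
    rw [bipartiteTensor_mul, trace_bipartiteTensor, Complex.mul_re, ← him]
    simp [a₀, a₁]
  have hsq : sdpFidelity (bipartiteTensor ρ₀ ρ₁) ^ 2 ≤ (a₀ * a₁) * (μ₀ * μ₁) := by
    refine sq_le_mul_of_forall_two_mul_le (mul_nonneg h₀.nonneg h₁.nonneg)
      (sdpFidelity_nonneg hρ) (mul_nonneg ha₀ ha₁) fun c hc => ?_
    have := ((h₀.bipartiteTensor h₁).rescale hc).two_mul_le (isGreatest_sdpValues hρ).1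
    rwa [smul_mul_assoc, trace_smul, Complex.real_smul, Complex.re_ofReal_mul, htr] at this
  have amgm : ∀ {a μ c : ℝ}, 0 ≤ a → 0 ≤ μ → a + μ ≤ 2 * c → a * μ ≤ c ^ 2 := by
    intro a μ c ha hμ h
    nlinarith [sq_nonneg (a - μ), mul_self_le_mul_self (add_nonneg ha hμ) h]
  refine le_of_sq_le_sq ?_ (mul_nonneg hp₀ hp₁)
  calc _ ≤ (a₀ * a₁) * (μ₀ * μ₁) := hsq
    _ = (a₀ * μ₀) * (a₁ * μ₁) := by ring
    _ ≤ c₀ ^ 2 * c₁ ^ 2 := mul_le_mul (amgm ha₀ h₀.nonneg hle₀) (amgm ha₁ h₁.nonneg hle₁)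
        (mul_nonneg ha₁ h₁.nonneg) (sq_nonneg _)
    _ = (c₀ * c₁) ^ 2 := by ring

theorem sdpFidelity_bipartiteTensor {ρ₀ : Matrix (A₀ × B₀) (A₀ × B₀) ℂ}
    {ρ₁ : Matrix (A₁ × B₁) (A₁ × B₁) ℂ} (hρ₀ : IsDensity ρ₀) (hρ₁ : IsDensity ρ₁) :
    sdpFidelity (bipartiteTensor ρ₀ ρ₁) = sdpFidelity ρ₀ * sdpFidelity ρ₁ := by
  refine le_antisymm ?_ (sdpFidelity_mul_le hρ₀ hρ₁)
  have hlim : Filter.Tendsto (fun ε : ℝ => (sdpFidelity ρ₀ + ε) * (sdpFidelity ρ₁ + ε))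
      (nhdsWithin 0 (Set.Ioi 0)) (nhds (sdpFidelity ρ₀ * sdpFidelity ρ₁)) := by
    have : Continuous fun ε : ℝ => (sdpFidelity ρ₀ + ε) * (sdpFidelity ρ₁ + ε) := by fun_prop
    simpa using (this.tendsto 0).mono_left nhdsWithin_le_nhds
  refine ge_of_tendsto hlim (Filter.eventually_of_mem self_mem_nhdsWithin fun ε hε => ?_)
  have hε' : 0 < ε := hε
  exact sdpFidelity_le_mul hρ₀ hρ₁ (by linarith) (by linarith)

end Multiplicativity

/-! ### The fidelity as a semidefinite program -/

section Fidelity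

lemma nhdsWithin_zero_Ioc_neBot : (nhdsWithin (0 : ℝ) (Set.Ioc 0 1)).NeBot := by
  rw [nhdsWithin_Ioc_eq_nhdsGT zero_lt_one]
  infer_instance

lemma posDef_add_smul_one {n : Type*} [DecidableEq n] {σ : Matrix n n ℂ} (hσ : 0 ≤ σ) {t : ℝ} (ht : 0 < t) :
    (σ + t • (1 : Matrix n n ℂ)).PosDef :=
  PosDef.posSemidef_add hσ.posSemidef (PosDef.one.smul ht)

variable {n : Type*} [Fintype n] [DecidableEq n]

/-- The square root `tr (√σ ρ √σ)^{1/2}` of the fidelity. -/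
noncomputable def rootFidelity (ρ σ : Matrix n n ℂ) : ℝ :=
  (CFC.sqrt (CFC.sqrt σ * ρ * CFC.sqrt σ)).trace.re

lemma fidelity_eq_rootFidelity_sq (ρ σ : Matrix n n ℂ) : fidelity ρ σ = rootFidelity ρ σ ^ 2 := rfl

lemma rootFidelity_nonneg (ρ σ : Matrix n n ℂ) : 0 ≤ rootFidelity ρ σ :=
  re_trace_nonneg (CFC.sqrt_nonneg _)

lemma conjTranspose_sqrt (σ : Matrix n n ℂ) : (CFC.sqrt σ)ᴴ = CFC.sqrt σ :=
  (CFC.sqrt_nonneg σ).posSemidef.isHermitian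

lemma sqrt_mul_mul_sqrt_nonneg {ρ : Matrix n n ℂ} (hρ : 0 ≤ ρ) (σ : Matrix n n ℂ) :
    0 ≤ CFC.sqrt σ * ρ * CFC.sqrt σ := by
  have h := hρ.posSemidef.mul_mul_conjTranspose_same (CFC.sqrt σ)
  rw [conjTranspose_sqrt] at h
  exact h.nonneg

open scoped Matrix.Norms.L2Operator in
lemma continuousOn_rootFidelity :
    ContinuousOn (fun p : Matrix n n ℂ × Matrix n n ℂ => rootFidelity p.1 p.2)
      {p | 0 ≤ p.1 ∧ 0 ≤ p.2} := by
  have hs : ContinuousOn (CFC.sqrt : Matrix n n ℂ → _) {σ | 0 ≤ σ} := CFC.continuousOn_sqrt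
  have h2 : ContinuousOn (fun p : Matrix n n ℂ × Matrix n n ℂ => CFC.sqrt p.2)
      {p | 0 ≤ p.1 ∧ 0 ≤ p.2} := hs.comp continuousOn_snd fun p hp => hp.2
  have hg := hs.comp ((h2.mul continuousOn_fst).mul h2)
    fun p hp => sqrt_mul_mul_sqrt_nonneg hp.1 p.2
  have ht : Continuous fun X : Matrix n n ℂ => X.trace.re := by fun_prop
  exact ht.comp_continuousOn hg

lemma isUnit_det_sqrt {σ : Matrix n n ℂ} (hσ : σ.PosDef) : IsUnit (CFC.sqrt σ).det := by
  rw [← isUnit_iff_isUnit_det, CFC.isUnit_sqrt_iff σ hσ.posSemidef.nonneg]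
  exact hσ.isUnit

/-- With `T = (√σ ρ √σ)^{1/2}`, the optimal off-diagonal block is `σ^{-1/2} T σ^{1/2}`. -/
lemma exists_posSemidef_re_trace_eq_rootFidelity {ρ σ : Matrix n n ℂ} (hρ : 0 ≤ ρ)
    (hσ : σ.PosDef) :
    ∃ X, (fromBlocks ρ X Xᴴ σ).PosSemidef ∧ X.trace.re = rootFidelity ρ σ := by
  set S := CFC.sqrt σ with hS
  set T := CFC.sqrt (S * ρ * S) with hT
  have hSS : S * S = σ := CFC.sqrt_mul_sqrt_self σ hσ.posSemidef.nonneg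
  have hTT : T * T = S * ρ * S := CFC.sqrt_mul_sqrt_self _ (sqrt_mul_mul_sqrt_nonneg hρ σ)
  have hu : IsUnit S.det := isUnit_det_sqrt hσ
  have hSh : Sᴴ = S := conjTranspose_sqrt σ
  have hTh : Tᴴ = T := conjTranspose_sqrt _
  refine ⟨S⁻¹ * T * S, ?_, ?_⟩
  · have h := posSemidef_conjTranspose_mul_self (fromCols (T * S⁻¹) S)
    rw [conjTranspose_fromCols_eq_fromRows_conjTranspose, fromRows_mul_fromCols] at h
    simp only [conjTranspose_mul, conjTranspose_nonsing_inv, hSh, hTh] at h ⊢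
    have e1 : S⁻¹ * T * (T * S⁻¹) = ρ := by
      rw [mul_assoc, ← mul_assoc T, hTT, mul_nonsing_inv_cancel_right _ _ hu,
        nonsing_inv_mul_cancel_left _ _ hu]
    rw [e1, hSS] at h
    simpa only [mul_assoc] using h
  · rw [mul_assoc, trace_mul_comm, mul_nonsing_inv_cancel_right _ _ hu]
    rfl

/-- With `T = (√σ ρ √σ)^{1/2}`, the block matrix with diagonal `σ^{1/2} T⁻¹ σ^{1/2}`,
`σ^{-1/2} T σ^{-1/2}` and off-diagonal `-1` certifies the optimality of the fidelity. -/
lemma re_trace_le_rootFidelity_of_posDef {ρ X σ : Matrix n n ℂ} (hρ : ρ.PosDef) (hσ : σ.PosDef)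
    (h : (fromBlocks ρ X Xᴴ σ).PosSemidef) : X.trace.re ≤ rootFidelity ρ σ := by
  set S := CFC.sqrt σ with hS
  set T := CFC.sqrt (S * ρ * S) with hT
  have hSS : S * S = σ := CFC.sqrt_mul_sqrt_self σ hσ.posSemidef.nonneg
  have hn := sqrt_mul_mul_sqrt_nonneg hρ.posSemidef.nonneg σ
  have hTT : T * T = S * ρ * S := CFC.sqrt_mul_sqrt_self _ hn
  have hu : IsUnit S.det := isUnit_det_sqrt hσ
  have huT : IsUnit T.det := by
    refine isUnit_det_sqrt (hn.posSemidef.posDef_iff_isUnit.mpr ?_)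
    rw [isUnit_iff_isUnit_det, det_mul, det_mul]
    exact (hu.mul ((isUnit_iff_isUnit_det _).mp hρ.isUnit)).mul hu
  have hSh : Sᴴ = S := conjTranspose_sqrt σ
  have hTh : Tᴴ = T := conjTranspose_sqrt _
  have hT0 : T.PosSemidef := (CFC.sqrt_nonneg _).posSemidef
  have hD := hT0.inv.mul_mul_conjTranspose_same (fromRows S (-(S⁻¹ * T)))
  rw [conjTranspose_fromRows_eq_fromCols_conjTranspose, fromRows_mul, fromRows_mul_fromCols] at hD
  simp only [conjTranspose_mul, conjTranspose_neg, conjTranspose_nonsing_inv, hSh, hTh] at hD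
  have e12 : S * T⁻¹ * (-(T * S⁻¹)) = -1 := by
    rw [mul_neg, mul_assoc, nonsing_inv_mul_cancel_left _ _ huT, mul_nonsing_inv _ hu]
  have e21 : -(S⁻¹ * T) * T⁻¹ * S = -1 := by
    rw [neg_mul, neg_mul, mul_nonsing_inv_cancel_right _ _ huT, nonsing_inv_mul _ hu]
  have e22 : -(S⁻¹ * T) * T⁻¹ * (-(T * S⁻¹)) = S⁻¹ * T * S⁻¹ := by
    rw [neg_mul, mul_nonsing_inv_cancel_right _ _ huT, neg_mul_neg, mul_assoc]
  rw [e12, e21, e22] at hD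
  have hp := re_trace_mul_nonneg hD.nonneg h.nonneg
  rw [trace_fromBlocks_mul_fromBlocks] at hp
  have t1 : (S * T⁻¹ * S * ρ).trace = T.trace := by
    rw [mul_assoc, mul_assoc, trace_mul_comm, mul_assoc, ← hTT,
      nonsing_inv_mul_cancel_left _ _ huT]
  have t2 : (S⁻¹ * T * S⁻¹ * σ).trace = T.trace := by
    rw [← hSS, ← mul_assoc, nonsing_inv_mul_cancel_right _ _ hu, trace_mul_comm,
      mul_nonsing_inv_cancel_left _ _ hu]
  simp [t1, t2] at hp
  change X.trace.re ≤ T.trace.re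
  linarith

open scoped Matrix.Norms.L2Operator in
lemma tendsto_rootFidelity_add {ρ σ Δ Δ' : Matrix n n ℂ} (hρ : 0 ≤ ρ) (hσ : 0 ≤ σ)
    (h : ∀ t : ℝ, t ∈ Set.Ioc 0 1 → 0 ≤ ρ + t • Δ ∧ 0 ≤ σ + t • Δ') :
    Filter.Tendsto (fun t : ℝ => rootFidelity (ρ + t • Δ) (σ + t • Δ'))
      (nhdsWithin 0 (Set.Ioc 0 1)) (nhds (rootFidelity ρ σ)) := by
  let γ : ℝ → Matrix n n ℂ × Matrix n n ℂ := fun t => (ρ + t • Δ, σ + t • Δ')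
  have hγ : Continuous γ := by fun_prop
  have h0 : γ 0 = (ρ, σ) := by simp [γ]
  have hmaps : Set.MapsTo γ (Set.Icc 0 1) {p | 0 ≤ p.1 ∧ 0 ≤ p.2} := by
    intro t ht
    rcases ht.1.eq_or_lt with rfl | hpos
    · rw [h0]; exact ⟨hρ, hσ⟩
    · exact h t ⟨hpos, ht.2⟩
  have hc := (continuousOn_rootFidelity (n := n)).comp hγ.continuousOn hmaps
  have hlim := (hc 0 (by simp)).tendsto.mono_left (nhdsWithin_mono _ Set.Ioc_subset_Icc_self)
  simpa [γ, Function.comp_def] using hlim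

/-- The singular case follows from the positive definite one by perturbing with the identity. -/
lemma re_trace_le_rootFidelity {ρ X σ : Matrix n n ℂ}
    (h : (fromBlocks ρ X Xᴴ σ).PosSemidef) : X.trace.re ≤ rootFidelity ρ σ := by
  have hρ : 0 ≤ ρ := by simpa using toBlocks₁₁_nonneg h.nonneg
  have hσ : 0 ≤ σ := by simpa using toBlocks₂₂_nonneg h.nonneg
  have := nhdsWithin_zero_Ioc_neBot
  refine ge_of_tendsto (tendsto_rootFidelity_add (Δ := 1) (Δ' := 1) hρ hσ fun t ht =>
    ⟨(posDef_add_smul_one hρ ht.1).posSemidef.nonneg,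
      (posDef_add_smul_one hσ ht.1).posSemidef.nonneg⟩)
    (Filter.eventually_of_mem self_mem_nhdsWithin fun t ht => ?_)
  refine re_trace_le_rootFidelity_of_posDef (posDef_add_smul_one hρ ht.1)
    (posDef_add_smul_one hσ ht.1) ?_
  have h1 := (posDef_add_smul_one h.nonneg ht.1).posSemidef
  rw [← fromBlocks_one, fromBlocks_smul, fromBlocks_add] at h1
  simpa using h1

lemma rootFidelity_pos {ρ σ : Matrix n n ℂ} (hρ : 0 ≤ ρ) (hρ0 : ρ ≠ 0) (hσ : σ.PosDef) :
    0 < rootFidelity ρ σ := by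
  refine (rootFidelity_nonneg ρ σ).lt_of_ne fun h => hρ0 ?_
  have hn := sqrt_mul_mul_sqrt_nonneg hρ σ
  have h0 : CFC.sqrt (CFC.sqrt σ * ρ * CFC.sqrt σ) = 0 :=
    eq_zero_of_re_trace_eq_zero (CFC.sqrt_nonneg (CFC.sqrt σ * ρ * CFC.sqrt σ)) h.symm
  rw [CFC.sqrt_eq_zero_iff _ hn] at h0
  have hu := isUnit_det_sqrt hσ
  have h1 := mul_nonsing_inv_cancel_right _ (CFC.sqrt σ * ρ) hu
  rw [h0, zero_mul] at h1
  have h2 := nonsing_inv_mul_cancel_left _ ρ hu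
  rw [← h1, mul_zero] at h2
  exact h2.symm

end Fidelity

/-! ### Trace-norm decompositions -/

section TraceNorm

variable {n : Type*} [Fintype n] [DecidableEq n]

lemma traceNorm_eq_re_trace_posPart_add_negPart {H : Matrix n n ℂ} (hH : H.IsHermitian) :
    traceNorm H = (H⁺ + H⁻).trace.re := by
  rw [CFC.posPart_add_negPart H hH]
  rfl

/-- The triangle inequality for the trace norm of a difference of positive semidefinite matrices,
proved by pairing with the sign of the difference. -/
lemma traceNorm_sub_le {M N : Matrix n n ℂ} (hM : 0 ≤ M) (hN : 0 ≤ N) :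
    traceNorm (M - N) ≤ (M + N).trace.re := by
  have hH : IsSelfAdjoint (M - N) := hM.posSemidef.isHermitian.sub hN.posSemidef.isHermitian
  have hcont : ∀ f : ℝ → ℝ, ContinuousOn f (spectrum ℝ (M - N)) := fun f =>
    (Matrix.finite_real_spectrum (A := M - N)).continuousOn f
  -- The spectrum is finite, so the discontinuous sign function is admissible.
  set s : ℝ → ℝ := fun x => SignType.sign x
  have habs : CFC.abs (M - N) = cfc s (M - N) * (M - N) := by
    have hmul := cfc_mul s id (M - N) (hcont s) (hcont id)
    rw [cfc_id ℝ (M - N) hH] at hmul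
    rw [CFC.abs_eq_cfc_norm (M - N) hH, ← hmul]
    congr 1
    ext x
    exact (sign_mul_self x).symm
  have hs : ∀ x, -1 ≤ s x ∧ s x ≤ 1 := fun x => by
    rcases lt_trichotomy x 0 with h | h | h <;> simp [s, h]
  have hle : cfc s (M - N) ≤ 1 := cfc_le_one s (M - N) fun x _ => (hs x).2
  have hge : -1 ≤ cfc s (M - N) := by
    simpa using algebraMap_le_cfc s (-1) (M - N) (fun x _ => (hs x).1) (hcont s) hH
  change (CFC.abs (M - N)).trace.re ≤ _
  have h1 := re_trace_mul_mono hM hle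
  have h2 := re_trace_mul_mono hN hge
  rw [habs, trace_mul_comm, sub_mul, trace_sub, Complex.sub_re, trace_add, Complex.add_re]
  simp at h1 h2
  linarith

variable {A B : Type*} [Fintype A] [Fintype B] [DecidableEq A] [DecidableEq B]

/-- The positive and negative parts of `partialTransposeB ω` parametrise the trace-norm
constraint in the definition of `PPT2`. -/
lemma mem_PPT2_iff {σ : Matrix (A × B) (A × B) ℂ} :
    σ ∈ PPT2 A B ↔ 0 ≤ σ ∧ ∃ M N : Matrix (A × B) (A × B) ℂ, 0 ≤ M ∧ 0 ≤ N ∧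
      -partialTransposeB M + partialTransposeB N ≤ partialTransposeB σ ∧
      partialTransposeB σ ≤ partialTransposeB M - partialTransposeB N ∧ (M + N).trace ≤ 1 := by
  refine and_congr_right fun _ => ⟨?_, ?_⟩
  · rintro ⟨ω, h1, h2, h3⟩
    have hω := nonneg_of_neg_le_of_le h1 h2
    have hH := isHermitian_partialTransposeB hω.posSemidef.isHermitian
    have hM := CFC.posPart_nonneg (partialTransposeB ω)
    have hN := CFC.negPart_nonneg (partialTransposeB ω)
    have hd : partialTransposeB (partialTransposeB ω)⁺ - partialTransposeB (partialTransposeB ω)⁻ =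
        ω := by
      rw [← partialTransposeB_sub, CFC.posPart_sub_negPart _ hH,
        partialTransposeB_partialTransposeB]
    refine ⟨_, _, hM, hN, ?_, by rwa [hd], ?_⟩
    · rwa [neg_add_eq_sub, ← neg_sub, hd]
    · rw [traceNorm_eq_re_trace_posPart_add_negPart hH] at h3
      exact Complex.le_def.mpr ⟨h3,
        (Complex.le_def.mp (add_nonneg hM hN).posSemidef.trace_nonneg).2.symm⟩
  · rintro ⟨M, N, hM, hN, h1, h2, h3⟩
    refine ⟨partialTransposeB (M - N), ?_, h2, ?_⟩
    · rwa [partialTransposeB_sub, neg_sub, sub_eq_neg_add]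
    · exact (traceNorm_sub_le hM hN).trans (Complex.le_def.mp h3).1

end TraceNorm

/-! ### Binegativity as the square of the semidefinite optimum -/

section Binegativity

variable {A B : Type*} [Fintype A] [Fintype B] [DecidableEq A] [DecidableEq B]

lemma rootFidelity_le_sdpFidelity_of_posDef {ρ σ : Matrix (A × B) (A × B) ℂ} (hρ : IsDensity ρ)
    (hσ : σ ∈ PPT2 A B) (hσ' : σ.PosDef) : rootFidelity ρ σ ≤ sdpFidelity ρ := by
  obtain ⟨-, M, N, hM, hN, h1, h2, h3⟩ := mem_PPT2_iff.mp hσ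
  obtain ⟨X, hP, hX⟩ := exists_posSemidef_re_trace_eq_rootFidelity hρ.1.nonneg hσ'
  exact (isGreatest_sdpValues hρ).2
    ⟨X, σ, M, N, hM, hN, h1, h2, h3, hP, by rw [re_trace_add_conjTranspose_div_two, hX]⟩

/-- Mixing an element of `PPT2` with the maximally mixed state stays inside `PPT2`. -/
lemma mix_mem_PPT2 [Nonempty (A × B)] {σ : Matrix (A × B) (A × B) ℂ} (hσ : σ ∈ PPT2 A B) {t : ℝ}
    (ht : t ∈ Set.Icc (0 : ℝ) 1) :
    (1 - t) • σ + t • ((Fintype.card (A × B) : ℝ)⁻¹ • 1) ∈ PPT2 A B := by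
  obtain ⟨h0, M, N, hM, hN, h1, h2, h3⟩ := mem_PPT2_iff.mp hσ
  have ht' : 0 ≤ 1 - t := by linarith [ht.2]
  have hd : (Fintype.card (A × B) : ℝ) ≠ 0 := by positivity
  set D : Matrix (A × B) (A × B) ℂ := (Fintype.card (A × B) : ℝ)⁻¹ • 1 with hD
  have hD0 : 0 ≤ D := smul_nonneg (by positivity) PosSemidef.one.nonneg
  have hDT : partialTransposeB D = D := by rw [hD, partialTransposeB_smul, partialTransposeB_one]
  have hDtr : D.trace.re = 1 := by
    rw [hD, trace_smul, trace_one, Complex.real_smul, Complex.re_ofReal_mul, Complex.natCast_re,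
      inv_mul_cancel₀ hd]
  have hM' := add_nonneg (smul_nonneg ht' hM) (smul_nonneg ht.1 hD0)
  have hN' := smul_nonneg ht' hN
  refine mem_PPT2_iff.mpr ⟨add_nonneg (smul_nonneg ht' h0) (smul_nonneg ht.1 hD0),
    (1 - t) • M + t • D, (1 - t) • N, hM', hN', ?_, ?_, ?_⟩
  · simp only [partialTransposeB_add, partialTransposeB_smul, hDT]
    have h := add_nonneg (smul_nonneg ht' (sub_nonneg.mpr h1))
      (smul_nonneg (by norm_num : (0 : ℝ) ≤ 2) (smul_nonneg ht.1 hD0))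
    rw [← sub_nonneg]
    convert h using 1
    module
  · simp only [partialTransposeB_add, partialTransposeB_smul, hDT]
    have h := smul_nonneg ht' (sub_nonneg.mpr h2)
    rw [← sub_nonneg]
    convert h using 1
    module
  · refine Complex.le_def.mpr ⟨?_,
      (Complex.le_def.mp (add_nonneg hM' hN').posSemidef.trace_nonneg).2.symm⟩
    have h3' := (Complex.le_def.mp h3).1
    simp only [trace_add, trace_smul, Complex.add_re, Complex.real_smul, Complex.re_ofReal_mul,
      hDtr, Complex.one_re] at h3' ⊢
    nlinarith

lemma IsDensity.nonempty {n : Type*} [Fintype n] {ρ : Matrix n n ℂ} (hρ : IsDensity ρ) :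
    Nonempty n := by
  by_contra h
  rw [not_nonempty_iff] at h
  simpa [Matrix.trace] using hρ.2

lemma posDef_inv_card_smul_one [Nonempty (A × B)] :
    ((Fintype.card (A × B) : ℝ)⁻¹ • (1 : Matrix (A × B) (A × B) ℂ)).PosDef :=
  PosDef.one.smul (by positivity : (0 : ℝ) < (Fintype.card (A × B) : ℝ)⁻¹)

lemma zero_mem_PPT2 : (0 : Matrix (A × B) (A × B) ℂ) ∈ PPT2 A B :=
  mem_PPT2_iff.mpr ⟨le_rfl, 0, 0, le_rfl, le_rfl, by simp, by simp, by simp⟩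

lemma sdpFidelity_pos {ρ : Matrix (A × B) (A × B) ℂ} (hρ : IsDensity ρ) : 0 < sdpFidelity ρ := by
  have := hρ.nonempty
  have hmem := mix_mem_PPT2 (zero_mem_PPT2 (A := A) (B := B)) (t := 1) (by simp)
  simp only [sub_self, smul_zero, zero_add, one_smul] at hmem
  have hρ0 : ρ ≠ 0 := by
    rintro rfl
    simpa using hρ.2
  exact (rootFidelity_pos hρ.1.nonneg hρ0 posDef_inv_card_smul_one).trans_le
    (rootFidelity_le_sdpFidelity_of_posDef hρ hmem posDef_inv_card_smul_one)

/-- Singular elements of `PPT2` are limits of positive definite ones. -/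
lemma rootFidelity_le_sdpFidelity {ρ σ : Matrix (A × B) (A × B) ℂ} (hρ : IsDensity ρ)
    (hσ : σ ∈ PPT2 A B) : rootFidelity ρ σ ≤ sdpFidelity ρ := by
  have := hρ.nonempty
  have := nhdsWithin_zero_Ioc_neBot
  set D : Matrix (A × B) (A × B) ℂ := (Fintype.card (A × B) : ℝ)⁻¹ • 1 with hD
  have hmix : ∀ t : ℝ, σ + t • (D - σ) = (1 - t) • σ + t • D := fun t => by module
  have hmem : ∀ t ∈ Set.Ioc (0 : ℝ) 1, σ + t • (D - σ) ∈ PPT2 A B := fun t ht => by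
    rw [hmix]
    exact mix_mem_PPT2 hσ ⟨ht.1.le, ht.2⟩
  refine le_of_tendsto (tendsto_rootFidelity_add (Δ := 0) (Δ' := D - σ) hρ.1.nonneg hσ.1
    fun t ht => ⟨by simpa using hρ.1.nonneg, (hmem t ht).1⟩)
    (Filter.eventually_of_mem self_mem_nhdsWithin fun t ht => ?_)
  rw [smul_zero, add_zero]
  refine rootFidelity_le_sdpFidelity_of_posDef hρ (hmem t ht) ?_
  rw [hmix]
  exact PosDef.posSemidef_add (smul_nonneg (by linarith [ht.2]) hσ.1).posSemidef
    (posDef_inv_card_smul_one.smul ht.1)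

theorem sSup_fidelity_PPT2 {ρ : Matrix (A × B) (A × B) ℂ} (hρ : IsDensity ρ) :
    sSup (fidelity ρ '' PPT2 A B) = sdpFidelity ρ ^ 2 := by
  refine IsGreatest.csSup_eq ⟨?_, ?_⟩
  · obtain ⟨X, σ, M, N, hM, hN, h1, h2, h3, hP, hv⟩ := (isGreatest_sdpValues hρ).1
    rw [re_trace_add_conjTranspose_div_two] at hv
    have hσ : 0 ≤ σ := by simpa using toBlocks₂₂_nonneg hP.nonneg
    have hmem : σ ∈ PPT2 A B := mem_PPT2_iff.mpr ⟨hσ, M, N, hM, hN, h1, h2, h3⟩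
    refine ⟨σ, hmem, ?_⟩
    rw [fidelity_eq_rootFidelity_sq]
    congr 1
    exact le_antisymm (rootFidelity_le_sdpFidelity hρ hmem)
      (hv.trans_le (re_trace_le_rootFidelity hP))
  · rintro _ ⟨σ, hσ, rfl⟩
    exact pow_le_pow_left₀ (rootFidelity_nonneg ρ σ) (rootFidelity_le_sdpFidelity hρ hσ) 2

lemma logFidelityBinegativity_eq {ρ : Matrix (A × B) (A × B) ℂ} (hρ : IsDensity ρ) :
    logFidelityBinegativity ρ = -(2 * Real.logb 2 (sdpFidelity ρ)) := by
  rw [logFidelityBinegativity, sSup_fidelity_PPT2 hρ, Real.logb_pow]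
  norm_num

end Binegativity

theorem mainTheorem2 {A₀ B₀ A₁ B₁ : Type*}
    [Fintype A₀] [Fintype B₀] [Fintype A₁] [Fintype B₁]
    [DecidableEq A₀] [DecidableEq B₀] [DecidableEq A₁] [DecidableEq B₁]
    (ρ₀ : Matrix (A₀ × B₀) (A₀ × B₀) ℂ) (ρ₁ : Matrix (A₁ × B₁) (A₁ × B₁) ℂ)
    (hρ₀ : IsDensity ρ₀) (hρ₁ : IsDensity ρ₁) :
    logFidelityBinegativity (bipartiteTensor ρ₀ ρ₁) =
        logFidelityBinegativity ρ₀ + logFidelityBinegativity ρ₁ ∧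
      sdpFidelity (bipartiteTensor ρ₀ ρ₁) = sdpFidelity ρ₀ * sdpFidelity ρ₁ := by
  have hmul := sdpFidelity_bipartiteTensor hρ₀ hρ₁
  refine ⟨?_, hmul⟩
  rw [logFidelityBinegativity_eq hρ₀, logFidelityBinegativity_eq hρ₁,
    logFidelityBinegativity_eq (hρ₀.bipartiteTensor hρ₁), hmul,
    Real.logb_mul (sdpFidelity_pos hρ₀).ne' (sdpFidelity_pos hρ₁).ne']
  ring
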